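/- Let $F_\infty$ be the free group on countably infinitely many generators, $\ell_2(F_\infty)$ the Hilbert space with orthonormal basis $\{e_x : x\in F_\infty\}$, $\lambda(x)e_y=e_{xy}$ the left regular representation, and $C^*_\lambda(F_\infty)\subset B(\ell_2(F_\infty))$ the norm closure of $\operatorname{span}\{\lambda(x):x\in F_\infty\}$. Let $C=\overline{\operatorname{span}}\{e_{i1}: i\in\mathbb N\}$ and $R=\overline{\operatorname{span}}\{e_{1i}: i\in\mathbb N\}$ in $B(\ell_2)$ be the column and row Hilbert spaces, and let $R(F_\infty)$ be $\ell_2(F_\infty)$ with the row operator space structure, i.e. $\overline{\operatorname{span}}\{e_{1,x}:x\in F_\infty\}\subset B(\ell_2(F_\infty))$, where $e_{1,x}\xi=\langle \xi,e_x\rangle e_1$ and $1$ is the identity of $F_\infty$. Let $\otimes$ be the spatial tensor product: for $X\subset B(H)$, $Y\subset B(K)$, $X\otimes Y$ is the norm closure of the algebraic tensor product in $B(H\otimes_2K)$. Regard $C\otimes C^*_\lambda(F_\infty)$ and $R\otimes R(F_\infty)$ as spaces of scalar families indexed by $\mathbb N\times F_\infty$, by letting $e_{i1}\otimes\lambda(x)$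 and $e_{1i}\otimes e_{1,x}$ both correspond to the unit family at $(i,x)$ (extended by continuity, for coordinatewise convergence of families), and let $$[\,C\otimes C^*_\lambda(F_\infty)\,]\cap[\,R\otimes R(F_\infty)\,]$$ be the intersection with the operator space structure in which the norm on $M_n$ is the maximum of the norms in $M_n(C\otimes C^*_\lambda(F_\infty))$ and $M_n(R\otimes R(F_\infty))$, for every $n\ge 1$. Then $$C^*_\lambda(F_\infty)\ \text{ is completely isomorphic to }\ [\,C\otimes C^*_\lambda(F_\infty)\,]\cap[\,R\otimes R(F_\infty)\,],$$ that is, there is a linear bijection $u$ from the first space onto the second such that $u$ and $u^{-1}$ are completely bounded. -/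

import Mathlib

open scoped TensorProduct

noncomputable section

namespace OpSpace

/-! ### Operator spaces

Operator spaces are concrete: a (closed) subspace `X` of `B(H)`, `H` a complex Hilbert space,
is a `Submodule ℂ (H →L[ℂ] H)`. -/

section General

variable {H K : Type*} [NormedAddCommGroup H] [InnerProductSpace ℂ H]
  [NormedAddCommGroup K] [InnerProductSpace ℂ K]

/-- The identification `M_n(B(H)) = B(ℓ₂ⁿ(H))`: the matrix `(T_ij)` acts on the Hilbert space sum
`H ⊕ ⋯ ⊕ H` by `(T ξ)_i = ∑_j T_ij ξ_j`. -/
def blockOp {n : ℕ} (T : Matrix (Fin n) (Fin n) (H →L[ℂ] H)) :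
    PiLp 2 (fun _ : Fin n => H) →L[ℂ] PiLp 2 (fun _ : Fin n => H) :=
  (PiLp.continuousLinearEquiv 2 ℂ (fun _ : Fin n => H)).symm.toContinuousLinearMap ∘L
    ContinuousLinearMap.pi fun i =>
      ∑ j, T i j ∘L PiLp.proj 2 (𝕜 := ℂ) (fun _ : Fin n => H) j

theorem blockOp_apply {n : ℕ} (T : Matrix (Fin n) (Fin n) (H →L[ℂ] H))
    (ξ : PiLp 2 (fun _ : Fin n => H)) (i : Fin n) :
    blockOp T ξ i = ∑ j, T i j (ξ j) := by
  simp [blockOp]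

/-- The norm on `M_n(X)`, for an operator space `X ⊆ B(H)`: that of `B(ℓ₂ⁿ(H))`. -/
def matNorm (X : Submodule ℂ (H →L[ℂ] H)) {n : ℕ} (T : Matrix (Fin n) (Fin n) X) : ℝ :=
  ‖blockOp (T.map fun x : X => (x : H →L[ℂ] H))‖

/-- `u : X → Y` is completely bounded: the norms of the maps
`u_n : M_n(X) → M_n(Y)`, `(x_ij) ↦ (u x_ij)`, are bounded uniformly in `n`. -/
def CompletelyBounded {X : Submodule ℂ (H →L[ℂ] H)} {Y : Submodule ℂ (K →L[ℂ] K)}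
    (u : X →ₗ[ℂ] Y) : Prop :=
  ∃ c : ℝ, ∀ (n : ℕ) (T : Matrix (Fin n) (Fin n) X), matNorm Y (T.map u) ≤ c * matNorm X T

/-- `X` and `Y` are completely isomorphic: there is a linear bijection `u : X → Y` with `u` and
`u⁻¹` completely bounded. -/
def CompletelyIsomorphic (X : Submodule ℂ (H →L[ℂ] H)) (Y : Submodule ℂ (K →L[ℂ] K)) : Prop :=
  ∃ u : X ≃ₗ[ℂ] Y,
    CompletelyBounded (u : X →ₗ[ℂ] Y) ∧ CompletelyBounded (u.symm : Y →ₗ[ℂ] X)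

/-! ### Spatial tensor product -/

variable (H K) in
/-- The Hilbert space tensor product `H ⊗₂ K`. -/
abbrev HTensor : Type _ := UniformSpace.Completion (H ⊗[ℂ] K)

/-- The elementary tensor `ξ ⊗ η` in `H ⊗₂ K`. -/
def vecTensor (ξ : H) (η : K) : HTensor H K := ((ξ ⊗ₜ[ℂ] η : H ⊗[ℂ] K) : HTensor H K)

/-- The operator `S ⊗ T` on `H ⊗₂ K`. -/
def opTensor (S : H →L[ℂ] H) (T : K →L[ℂ] K) : HTensor H K →L[ℂ] HTensor H K :=
  (TensorProduct.mapL S T).completion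

theorem opTensor_vecTensor (S : H →L[ℂ] H) (T : K →L[ℂ] K) (ξ : H) (η : K) :
    opTensor S T (vecTensor ξ η) = vecTensor (S ξ) (T η) := by
  simp [opTensor, vecTensor]

/-- The spatial tensor product `X ⊗ Y` of `X ⊆ B(H)` and `Y ⊆ B(K)`: the closure in `B(H ⊗₂ K)`
of the span of the operators `S ⊗ T`, `S ∈ X`, `T ∈ Y`. -/
def spatialTensor (X : Submodule ℂ (H →L[ℂ] H)) (Y : Submodule ℂ (K →L[ℂ] K)) :
    Submodule ℂ (HTensor H K →L[ℂ] HTensor H K) :=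
  (Submodule.span ℂ (Set.image2 opTensor (X : Set (H →L[ℂ] H)) Y)).topologicalClosure

/-! ### Intersection of operator spaces -/

/-- The block diagonal operator `S ⊕ T` on the Hilbert space sum `H ⊕ K`, linear in `(S, T)`. -/
def diagOp : ((H →L[ℂ] H) × (K →L[ℂ] K)) →ₗ[ℂ] (WithLp 2 (H × K) →L[ℂ] WithLp 2 (H × K)) where
  toFun p := (WithLp.prodContinuousLinearEquiv 2 ℂ H K).symm.toContinuousLinearMap ∘L
    (p.1.prodMap p.2) ∘L (WithLp.prodContinuousLinearEquiv 2 ℂ H K).toContinuousLinearMap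
  map_add' _ _ := rfl
  map_smul' _ _ := rfl

theorem diagOp_apply (S : H →L[ℂ] H) (T : K →L[ℂ] K) (x : WithLp 2 (H × K)) :
    diagOp (S, T) x = WithLp.toLp 2 (S x.fst, T x.snd) := rfl

/-- The intersection `X ∩ Y` of operator spaces `X ⊆ B(H)`, `Y ⊆ B(K)` that are both regarded as
subspaces of a vector space `V` through linear maps `j`, `k` (injective on `X`, respectively `Y`).
An element of the intersection is a pair `(S, T) ∈ X × Y` with `j S = k T`; representing the pair
by `S ⊕ T` on `H ⊕ K` gives `M_n(X ∩ Y)` the norm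
`max (‖(S_ij)‖_{M_n(X)}, ‖(T_ij)‖_{M_n(Y)})`. -/
def interSpace {V : Type*} [AddCommGroup V] [Module ℂ V]
    (X : Submodule ℂ (H →L[ℂ] H)) (j : (H →L[ℂ] H) →ₗ[ℂ] V)
    (Y : Submodule ℂ (K →L[ℂ] K)) (k : (K →L[ℂ] K) →ₗ[ℂ] V) :
    Submodule ℂ (WithLp 2 (H × K) →L[ℂ] WithLp 2 (H × K)) :=
  (X.prod Y ⊓ LinearMap.eqLocus (j ∘ₗ LinearMap.fst ℂ _ _) (k ∘ₗ LinearMap.snd ℂ _ _)).map diagOp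

/-- The matrix coefficient `T ↦ ⟨T ξ, η⟩` (linear in `T`). -/
def coeffFun (ξ η : H) : (H →L[ℂ] H) →ₗ[ℂ] ℂ where
  toFun T := inner ℂ η (T ξ)
  map_add' S T := by simp
  map_smul' c T := by simp

end General

/-! ### Column and row Hilbert spaces -/

/-- `ℓ₂(ι)`. -/
abbrev L2 (ι : Type*) : Type _ := lp (fun _ : ι => ℂ) 2

section RowColumn

variable {ι : Type*} [DecidableEq ι]

/-- The orthonormal basis vector `e_i` of `ℓ₂(ι)`. -/
def bvec (i : ι) : L2 ι := lp.single 2 i 1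

/-- The matrix unit `e_ij` in `B(ℓ₂(ι))`: `e_ij ξ = ⟨ξ, e_j⟩ e_i`. -/
def matUnit (i j : ι) : L2 ι →L[ℂ] L2 ι := InnerProductSpace.rankOne ℂ (bvec i) (bvec j)

theorem inner_bvec (i j : ι) :
    inner ℂ (bvec i) (bvec j) = if i = j then (1 : ℂ) else 0 := by
  rw [bvec, lp.inner_single_left]
  by_cases h : i = j
  · subst h
    simp [bvec]
  · simp [bvec, h]

theorem norm_bvec (i : ι) : ‖(bvec i : L2 ι)‖ = 1 := by
  rw [bvec, lp.norm_single (by norm_num), norm_one]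

theorem matUnit_bvec (i j k : ι) : matUnit i j (bvec k) = if j = k then bvec i else 0 := by
  rw [matUnit, InnerProductSpace.rankOne_apply, inner_bvec, ite_smul, one_smul, zero_smul]

variable (ι) in
/-- The column Hilbert space over `ι`, realized in the column `o`. -/
def colSpace (o : ι) : Submodule ℂ (L2 ι →L[ℂ] L2 ι) :=
  (Submodule.span ℂ (Set.range fun i : ι => matUnit i o)).topologicalClosure

variable (ι) in
/-- The row Hilbert space over `ι` (that is, `ℓ₂(ι)` with the row operator space structure),
realized in the row `o`; the basis vector `e_i` of `ℓ₂(ι)` corresponds to `e_{oi}`. -/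
def rowSpace (o : ι) : Submodule ℂ (L2 ι →L[ℂ] L2 ι) :=
  (Submodule.span ℂ (Set.range fun i : ι => matUnit o i)).topologicalClosure

end RowColumn

/-! ### The reduced group C*-algebra -/

section Group

variable {G : Type*} [Group G]

/-- The left regular representation: `(λ(g) f)(x) = f(g⁻¹ x)`, that is, `λ(g) e_x = e_{gx}`. -/
def leftReg (g : G) : L2 G →L[ℂ] L2 G :=
  LinearIsometry.toContinuousLinearMap
    { toFun := fun f => ⟨fun x => f (g⁻¹ * x), by
        have hp : 0 < (2 : ENNReal).toReal := by norm_num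
        exact (memℓp_gen_iff hp).mpr
          ((Equiv.mulLeft g⁻¹).summable_iff.mpr ((memℓp_gen_iff hp).mp (lp.memℓp f)))⟩
      map_add' := fun _ _ => rfl
      map_smul' := fun _ _ => rfl
      norm_map' := fun f => by
        have hp : 0 < (2 : ENNReal).toReal := by norm_num
        rw [lp.norm_eq_tsum_rpow hp, lp.norm_eq_tsum_rpow hp]
        congr 1
        exact (Equiv.mulLeft g⁻¹).tsum_eq fun x => ‖f x‖ ^ (2 : ENNReal).toReal }

theorem leftReg_bvec [DecidableEq G] (g x : G) : leftReg g (bvec x) = bvec (g * x) := by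
  ext y
  change (lp.single 2 x (1 : ℂ) : L2 G) (g⁻¹ * y) = (lp.single 2 (g * x) (1 : ℂ) : L2 G) y
  by_cases h : y = g * x
  · subst h
    simp
  · rw [lp.single_apply_ne, lp.single_apply_ne]
    · exact h
    · rwa [Ne, inv_mul_eq_iff_eq_mul]

variable (G) in
/-- `C*_λ(G)`: the norm closure in `B(ℓ₂(G))` of the span of the operators `λ(g)`. -/
def reducedCStar : Submodule ℂ (L2 G →L[ℂ] L2 G) :=
  (Submodule.span ℂ (Set.range (leftReg : G → L2 G →L[ℂ] L2 G))).topologicalClosure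

/-! ### The compatible couple `C ⊗ C*_λ(G)`, `R ⊗ R(G)`

Both spaces are regarded as spaces of scalar families indexed by `ℕ × G`: the family
`(a_{i,g})` stands for `∑ a_{i,g} e_{i0} ⊗ λ(g)` in the first space and for
`∑ a_{i,g} e_{0i} ⊗ e_{1g}` in the second. -/

variable [DecidableEq G]

variable (G) in
/-- The coefficients of an element of `C ⊗ C*_λ(G)`:
`a_{i,g} = ⟨u (e_0 ⊗ e_1), e_i ⊗ e_g⟩`. -/
def colCoeff : (HTensor (L2 ℕ) (L2 G) →L[ℂ] HTensor (L2 ℕ) (L2 G)) →ₗ[ℂ] (ℕ × G → ℂ) :=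
  LinearMap.pi fun p =>
    coeffFun (vecTensor (bvec 0) (bvec 1)) (vecTensor (bvec p.1) (bvec p.2))

variable (G) in
/-- The coefficients of an element of `R ⊗ R(G)`:
`a_{i,g} = ⟨v (e_i ⊗ e_g), e_0 ⊗ e_1⟩`. -/
def rowCoeff : (HTensor (L2 ℕ) (L2 G) →L[ℂ] HTensor (L2 ℕ) (L2 G)) →ₗ[ℂ] (ℕ × G → ℂ) :=
  LinearMap.pi fun p =>
    coeffFun (vecTensor (bvec p.1) (bvec p.2)) (vecTensor (bvec 0) (bvec 1))

theorem colCoeff_tensor (i : ℕ) (g : G) :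
    colCoeff G (opTensor (matUnit i 0) (leftReg g)) = Pi.single (i, g) 1 := by
  ext ⟨k, h⟩
  simp only [colCoeff, coeffFun, LinearMap.pi_apply, LinearMap.coe_mk, AddHom.coe_mk,
    opTensor_vecTensor, leftReg_bvec, matUnit_bvec, if_true, mul_one]
  simp [vecTensor, inner_bvec, Pi.single_apply, ite_and]
  grind

theorem rowCoeff_tensor (i : ℕ) (g : G) :
    rowCoeff G (opTensor (matUnit 0 i) (matUnit 1 g)) = Pi.single (i, g) 1 := by
  ext ⟨k, h⟩
  simp only [rowCoeff, coeffFun, LinearMap.pi_apply, LinearMap.coe_mk, AddHom.coe_mk,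
    opTensor_vecTensor, matUnit_bvec]
  by_cases h1 : i = k <;> by_cases h2 : g = h <;>
    simp [vecTensor, norm_bvec, h1, h2, eq_comm]

end Group

end OpSpace

end

/-! Write F for the group, X for C*_λ(F) and Y for the intersection space. The proof is a Pełczyński
decomposition. Let g_i be the even generators, F' ≅ F the subgroup generated by the odd ones, and E
the set of all g_i x with x in F'.

(1) Y is completely complemented in X as the part supported by E. Restriction to E maps X to Y
(`interBound_comp_evenOdd`), because both matrices defining Y are submatrices of the group matrix;
extension by zero maps Y back to X (`kernelBound_extend_evenOdd`). Hence X ≅ Z ⊕ Y. (2) The column i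
= 0 of Y is a copy of X (`interBound_single_col`, `groupKernel_zero_col`), and the other columns
form a copy of Y. Hence Y ≅ X ⊕ Y. (3) Splitting i by parity gives Y ≅ Y ⊕ Y (`InterBound.reindex`).
Together, Y ≅ X ⊕ Y ≅ Z ⊕ Y ⊕ Y ≅ Z ⊕ Y ≅ X. The composite merely permutes coefficients, through
`indexEquiv`.

The inequality with content is the extension in (1), of Haagerup type. Take a matrix entry (t, s)
with t s⁻¹ = g_i x. If the reduced word t begins with g_i, then t = g_i (x s), and these entries
form a compression of the column operator amplified over the right cosets of F'
(`kernelBound_creation`). Otherwise s = x⁻¹ g_i⁻¹ t with no cancellation before t, so s determines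
i, x and t, and these entries form a compression of the amplified row operator
(`kernelBound_annihilation`).

All estimates concern scalar matrices with an arbitrary amplification index κ, so they are complete.
They pass to the closed spaces because finitely supported families are dense in Y (`interSpace_eq`).
-/

noncomputable section

namespace OpSpace

/-! ### Infinite scalar matrices that are bounded on `ℓ₂` -/

section Kernel

variable {P Q P' Q' Z : Type*}

/-- The infinite matrix `a` defines an operator `ℓ₂(Q) → ℓ₂(P)` of norm at most `C`. -/
def KernelBound (a : P → Q → ℂ) (C : ℝ) : Prop :=
  ∀ (s : Finset P) (t : Finset Q) (η : P → ℂ) (ξ : Q → ℂ),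
    ‖∑ p ∈ s, ∑ q ∈ t, η p * a p q * ξ q‖
      ≤ C * √(∑ p ∈ s, ‖η p‖ ^ 2) * √(∑ q ∈ t, ‖ξ q‖ ^ 2)

theorem KernelBound.add {a b : P → Q → ℂ} {C D : ℝ} (ha : KernelBound a C)
    (hb : KernelBound b D) : KernelBound (a + b) (C + D) := by
  intro s t η ξ
  have h : ∑ p ∈ s, ∑ q ∈ t, η p * (a + b) p q * ξ q
      = (∑ p ∈ s, ∑ q ∈ t, η p * a p q * ξ q) + ∑ p ∈ s, ∑ q ∈ t, η p * b p q * ξ q := by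
    simp only [← Finset.sum_add_distrib, Pi.add_apply]
    exact Finset.sum_congr rfl fun p _ => Finset.sum_congr rfl fun q _ => by ring
  rw [h]
  refine (norm_add_le _ _).trans ((add_le_add (ha s t η ξ) (hb s t η ξ)).trans (le_of_eq ?_))
  ring

theorem KernelBound.neg {a : P → Q → ℂ} {C : ℝ} (ha : KernelBound a C) :
    KernelBound (-a) C := by
  intro s t η ξ
  have := ha s t η ξ
  simpa [Finset.sum_neg_distrib] using this

theorem KernelBound.sub {a b : P → Q → ℂ} {C D : ℝ} (ha : KernelBound a C)
    (hb : KernelBound b D) : KernelBound (a - b) (C + D) := by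
  rw [sub_eq_add_neg]
  exact ha.add hb.neg

theorem KernelBound.sum_comp_le {a : P → Q → ℂ} {C : ℝ} (ha : KernelBound a C)
    {m : P' → P} {r : Q' → Q} {s : Finset P'} {t : Finset Q'} (hm : Set.InjOn m s)
    (hr : Set.InjOn r t) (η : P' → ℂ) (ξ : Q' → ℂ) :
    ‖∑ p ∈ s, ∑ q ∈ t, η p * a (m p) (r q) * ξ q‖
      ≤ C * √(∑ p ∈ s, ‖η p‖ ^ 2) * √(∑ q ∈ t, ‖ξ q‖ ^ 2) := by
  classical
  rcases isEmpty_or_nonempty P' with hP | hP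
  · have : s = ∅ := Finset.eq_empty_of_isEmpty s
    simp [this]
  rcases isEmpty_or_nonempty Q' with hQ | hQ
  · have : t = ∅ := Finset.eq_empty_of_isEmpty t
    simp [this]
  -- The vectors are carried to the images by the inverses of `m` on `s` and `r` on `t`; values off
  -- the images never enter.
  have key := ha (s.image m) (t.image r) (fun p => η (Function.invFunOn m s p))
    (fun q => ξ (Function.invFunOn r t q))
  simp only [Finset.sum_image hm, Finset.sum_image hr] at key
  have h1 : ∀ p ∈ s, Function.invFunOn m s (m p) = p := fun p hp => hm.leftInvOn_invFunOn hp
  have h2 : ∀ q ∈ t, Function.invFunOn r t (r q) = q := fun q hq => hr.leftInvOn_invFunOn hq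
  have e1 : ∑ p ∈ s, ‖η (Function.invFunOn m s (m p))‖ ^ 2 = ∑ p ∈ s, ‖η p‖ ^ 2 :=
    Finset.sum_congr rfl fun p hp => by rw [h1 p hp]
  have e2 : ∑ q ∈ t, ‖ξ (Function.invFunOn r t (r q))‖ ^ 2 = ∑ q ∈ t, ‖ξ q‖ ^ 2 :=
    Finset.sum_congr rfl fun q hq => by rw [h2 q hq]
  rw [e1, e2] at key
  refine le_trans (le_of_eq ?_) key
  congr 1
  exact Finset.sum_congr rfl fun p hp => Finset.sum_congr rfl fun q hq => by
    rw [h1 p hp, h2 q hq]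

theorem sum_fiber_sqrt_sq_le [DecidableEq Z] (u : P → Z) (A : Set P) [DecidablePred (· ∈ A)]
    (I : Finset Z) (s : Finset P) (f : P → ℂ) :
    ∑ z ∈ I, √(∑ p ∈ s with p ∈ A ∧ u p = z, ‖f p‖ ^ 2) ^ 2 ≤ ∑ p ∈ s, ‖f p‖ ^ 2 := by
  rw [Finset.sum_congr rfl fun z _ => Real.sq_sqrt (Finset.sum_nonneg fun _ _ => sq_nonneg _)]
  simp only [Finset.sum_filter]
  rw [Finset.sum_comm]
  refine Finset.sum_le_sum fun p _ => ?_
  by_cases hw : u p ∈ I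
  · rw [Finset.sum_eq_single_of_mem (u p) hw fun z _ hz => by simp [Ne.symm hz]]
    split_ifs <;> simp
  · rw [Finset.sum_eq_zero fun z hz => ?_]
    · positivity
    · rw [if_neg]
      rintro ⟨-, rfl⟩
      exact hw hz

/-- Compression of the amplification `a ⊗ 1_{ℓ₂(Z)}` by the partial isometries given by
partially defined injections of the index sets. -/
theorem KernelBound.compress_amplify {a : P → Q → ℂ} {C : ℝ} (hC : 0 ≤ C) (ha : KernelBound a C)
    {b : P' → Q' → ℂ} {A : Set P'} {B : Set Q'} {u : P' → Z} {v : Q' → Z} {m : P' → P} {r : Q' → Q}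
    (hm : Set.InjOn (fun p => (u p, m p)) A) (hr : Set.InjOn (fun q => (v q, r q)) B)
    (h : ∀ p q, p ∈ A → q ∈ B → u p = v q → b p q = a (m p) (r q))
    (h' : ∀ p q, ¬ (p ∈ A ∧ q ∈ B ∧ u p = v q) → b p q = 0) : KernelBound b C := by
  classical
  intro s t η ξ
  set S : Z → Finset P' := fun z => {p ∈ s | p ∈ A ∧ u p = z} with hS
  set T : Z → Finset Q' := fun z => {q ∈ t | q ∈ B ∧ v q = z} with hT
  set I := s.image u with hI
  -- Entries between different fibres vanish, so the form splits over z. On each fibre `m` and `r`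
  -- are injective, and Cauchy–Schwarz in z recombines the bounds.
  have hsum : ∑ p ∈ s, ∑ q ∈ t, η p * b p q * ξ q
      = ∑ z ∈ I, ∑ p ∈ S z, ∑ q ∈ T z, η p * a (m p) (r q) * ξ q := by
    simp only [hS, hT, Finset.sum_filter]
    conv_rhs => rw [Finset.sum_comm]
    refine Finset.sum_congr rfl fun p hp => ?_
    rw [Finset.sum_eq_single (u p)]
    · by_cases hA : p ∈ A
      · simp only [hA, true_and, if_true]
        refine Finset.sum_congr rfl fun q _ => ?_
        split_ifs with hq
        · rw [h p q hA hq.1 hq.2.symm]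
        · rw [h' p q (fun hh => hq ⟨hh.2.1, hh.2.2.symm⟩)]
          simp
      · simp only [hA, false_and, if_false]
        exact Finset.sum_eq_zero fun q _ => by rw [h' p q (fun hh => hA hh.1)]; simp
    · intro z _ hz
      simp [Ne.symm hz]
    · intro hn
      exact absurd (Finset.mem_image_of_mem u hp) hn
  rw [hsum]
  calc ‖∑ z ∈ I, ∑ p ∈ S z, ∑ q ∈ T z, η p * a (m p) (r q) * ξ q‖
      ≤ ∑ z ∈ I, C * (√(∑ p ∈ S z, ‖η p‖ ^ 2) * √(∑ q ∈ T z, ‖ξ q‖ ^ 2)) := by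
        refine norm_sum_le_of_le _ fun z _ => ?_
        rw [← mul_assoc]
        refine ha.sum_comp_le ?_ ?_ η ξ
        · intro p hp p' hp' e
          simp only [hS, Finset.coe_filter, Set.mem_ofPred_eq] at hp hp'
          exact hm hp.2.1 hp'.2.1 (Prod.ext (hp.2.2.trans hp'.2.2.symm) e)
        · intro p hp p' hp' e
          simp only [hT, Finset.coe_filter, Set.mem_ofPred_eq] at hp hp'
          exact hr hp.2.1 hp'.2.1 (Prod.ext (hp.2.2.trans hp'.2.2.symm) e)
    _ ≤ C * (√(∑ p ∈ s, ‖η p‖ ^ 2) * √(∑ q ∈ t, ‖ξ q‖ ^ 2)) := by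
        rw [← Finset.mul_sum]
        refine mul_le_mul_of_nonneg_left ?_ hC
        refine (Real.sum_mul_le_sqrt_mul_sqrt _ _ _).trans ?_
        exact mul_le_mul (Real.sqrt_le_sqrt (sum_fiber_sqrt_sq_le u A I s η))
          (Real.sqrt_le_sqrt (sum_fiber_sqrt_sq_le v B I t ξ))
          (Real.sqrt_nonneg _) (Real.sqrt_nonneg _)
    _ = _ := by ring

theorem KernelBound.compress {a : P → Q → ℂ} {C : ℝ} (hC : 0 ≤ C) (ha : KernelBound a C)
    {b : P' → Q' → ℂ} (A : Set P') (B : Set Q') (m : P' → P) (r : Q' → Q)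
    (hm : Set.InjOn m A) (hr : Set.InjOn r B)
    (h : ∀ p q, p ∈ A → q ∈ B → b p q = a (m p) (r q))
    (h' : ∀ p q, ¬ (p ∈ A ∧ q ∈ B) → b p q = 0) : KernelBound b C :=
  ha.compress_amplify hC (A := A) (B := B) (u := fun _ => ()) (v := fun _ => ()) (m := m) (r := r)
    (fun _ hp _ hq e => hm hp hq (congrArg Prod.snd e))
    (fun _ hp _ hq e => hr hp hq (congrArg Prod.snd e))
    (fun p q hp hq _ => h p q hp hq) (fun p q hn => h' p q fun hh => hn ⟨hh.1, hh.2, rfl⟩)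

/-- Entries of a fixed column are square summable. -/
theorem KernelBound.sum_sq_le {a : P → Q → ℂ} {C : ℝ} (hC : 0 ≤ C) (ha : KernelBound a C) (q : Q)
    (s : Finset P) : √(∑ p ∈ s, ‖a p q‖ ^ 2) ≤ C := by
  -- Testing the column against its own conjugate gives x ≤ C √x for its square sum x.
  have h := ha s {q} (fun p => star (a p q)) (fun _ => 1)
  simp only [Finset.sum_singleton, mul_one, norm_one, one_pow, Real.sqrt_one,
    RCLike.star_def, RCLike.conj_mul, RCLike.norm_conj] at h
  set x := ∑ p ∈ s, ‖a p q‖ ^ 2 with hx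
  have hx0 : 0 ≤ x := Finset.sum_nonneg fun _ _ => by positivity
  have e : (∑ p ∈ s, ((‖a p q‖ : ℂ)) ^ 2) = (x : ℂ) := by push_cast [hx]; rfl
  have e' : ‖∑ p ∈ s, ((‖a p q‖ : ℂ)) ^ 2‖ = x := by
    rw [e, Complex.norm_real, Real.norm_of_nonneg hx0]
  have h2 : x ≤ C * √x := e' ▸ h
  rcases (Real.sqrt_nonneg x).eq_or_lt with h0 | h0
  · rwa [← h0]
  · refine le_of_mul_le_mul_right ?_ h0
    rwa [Real.mul_self_sqrt hx0]

end Kernel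

/-! ### Words in the free group

The generators with an even index serve as `g_i`, those with an odd index generate a subgroup
isomorphic to the whole group. -/

section Words

open FreeGroup

/-- The embedding of the free group onto the subgroup generated by the odd generators. -/
def oddHom : FreeGroup ℕ →* FreeGroup ℕ := FreeGroup.map fun n => 2 * n + 1

/-- A left inverse of `oddHom`, trivial on the even generators. -/
def oddRetract : FreeGroup ℕ →* FreeGroup ℕ :=
  FreeGroup.lift fun n => if n % 2 = 1 then of (n / 2) else 1

/-- The element `g_i x`, `x` in the subgroup generated by the odd generators. -/
def evenOdd (p : ℕ × FreeGroup ℕ) : FreeGroup ℕ := of (2 * p.1) * oddHom p.2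

theorem oddRetract_oddHom (x : FreeGroup ℕ) : oddRetract (oddHom x) = x := by
  have : oddRetract.comp oddHom = MonoidHom.id _ := by
    ext n
    have h : (2 * n + 1) / 2 = n := by omega
    simp [oddRetract, oddHom, h]
  exact DFunLike.congr_fun this x

theorem oddHom_injective : Function.Injective oddHom :=
  Function.LeftInverse.injective oddRetract_oddHom

theorem oddRetract_evenOdd (p : ℕ × FreeGroup ℕ) : oddRetract (evenOdd p) = p.2 := by
  rw [evenOdd, _root_.map_mul, oddRetract_oddHom]
  simp [oddRetract]

theorem evenOdd_injective : Function.Injective evenOdd := by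
  intro p q h
  have h2 : p.2 = q.2 := by rw [← oddRetract_evenOdd, h, oddRetract_evenOdd]
  have h1 : (of (2 * p.1) : FreeGroup ℕ) = of (2 * q.1) := by
    simpa [evenOdd, h2] using h
  have := of_injective h1
  exact Prod.ext (by omega) h2

theorem toWord_oddHom (x : FreeGroup ℕ) :
    (oddHom x).toWord = x.toWord.map fun l => (2 * l.1 + 1, l.2) := by
  conv_lhs => rw [← mk_toWord (x := x), oddHom, map.mk, toWord_mk]
  refine FreeGroup.IsReduced.reduce_eq ?_
  have h := isReduced_toWord (x := x)
  rw [FreeGroup.IsReduced, List.isChain_map]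
  refine h.imp fun a b hab e => hab ?_
  simpa using e

theorem toWord_inv_of_mul {n : ℕ} {t : FreeGroup ℕ} (h : t.toWord.head? ≠ some (n, true)) :
    ((of n)⁻¹ * t).toWord = (n, false) :: t.toWord := by
  rw [toWord_mul, toWord_inv, toWord_of]
  change reduce ((n, false) :: t.toWord) = _
  refine FreeGroup.IsReduced.reduce_eq ?_
  rw [FreeGroup.IsReduced, List.isChain_cons]
  refine ⟨fun y hy e => ?_, isReduced_toWord⟩
  obtain ⟨y1, y2⟩ := y
  cases y2
  · rfl
  · simp only at e
    subst e
    exact absurd hy h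

/-- A letter of odd index cannot cancel against the even letter that opens `v`. -/
theorem toWord_oddHom_mul {n : ℕ} {b : Bool} {L : List (ℕ × Bool)} {v : FreeGroup ℕ}
    (hv : v.toWord = (2 * n, b) :: L) (y : FreeGroup ℕ) :
    (oddHom y * v).toWord = (y.toWord.map fun l => (2 * l.1 + 1, l.2)) ++ v.toWord := by
  rw [toWord_mul, toWord_oddHom]
  refine FreeGroup.IsReduced.reduce_eq ?_
  have h1 := isReduced_toWord (x := oddHom y)
  rw [toWord_oddHom] at h1
  rw [FreeGroup.IsReduced, List.isChain_append]
  refine ⟨h1, isReduced_toWord, fun p hp q hq e => ?_⟩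
  rw [hv] at hq
  simp only [List.head?_cons, Option.mem_def, Option.some.injEq] at hq
  have hp' := List.mem_of_mem_getLast? hp
  rw [List.mem_map] at hp'
  obtain ⟨l, -, rfl⟩ := hp'
  subst hq
  simp only at e
  omega

/-- An element is in at most one way of the form `x⁻¹ g_i⁻¹ t` with `x` in the odd subgroup and no
cancellation between `g_i⁻¹` and `t`. -/
theorem evenOdd_inv_mul_inj {p q : ℕ × FreeGroup ℕ} {t w : FreeGroup ℕ}
    (ht : t.toWord.head? ≠ some (2 * p.1, true)) (hw : w.toWord.head? ≠ some (2 * q.1, true))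
    (h : (evenOdd p)⁻¹ * t = (evenOdd q)⁻¹ * w) : p = q ∧ t = w := by
  have h1 := toWord_inv_of_mul ht
  have h2 := toWord_inv_of_mul hw
  -- Both odd factors are collected on one side. If their product were nontrivial, that side would
  -- begin with an odd letter and the other with an even one.
  have h3 : oddHom (q.2 * p.2⁻¹) * ((of (2 * p.1))⁻¹ * t) = (of (2 * q.1))⁻¹ * w := by
    have : oddHom q.2 * ((evenOdd p)⁻¹ * t) = oddHom q.2 * ((evenOdd q)⁻¹ * w) := by rw [h]
    simpa [evenOdd, mul_assoc] using this
  have h4 := toWord_oddHom_mul h1 (q.2 * p.2⁻¹)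
  rw [h3, h1, h2] at h4
  have hy : q.2 * p.2⁻¹ = 1 := by
    rw [← toWord_eq_nil_iff]
    by_contra hne
    obtain ⟨l, L, hL⟩ := List.exists_cons_of_ne_nil hne
    rw [hL] at h4
    simp only [List.map_cons, List.cons_append, List.cons.injEq, Prod.mk.injEq] at h4
    omega
  rw [hy] at h4
  simp only [toWord_one, List.map_nil, List.nil_append, List.cons.injEq, Prod.mk.injEq] at h4
  have hpq : p = q := Prod.ext (by omega) (mul_inv_eq_one.mp hy).symm
  exact ⟨hpq, (toWord_injective h4.2).symm⟩

end Words

/-! ### The matrices of elements of the three spaces -/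

section GroupKernels

variable {κ G : Type*} [Group G] [DecidableEq G]

/-- The matrix of `∑ a_kl(g) e_kl ⊗ λ(g)`. -/
def groupKernel (a : κ → κ → G → ℂ) : κ × G → κ × G → ℂ :=
  fun p q => a p.1 q.1 (p.2 * q.2⁻¹)

/-- The matrix of `∑ a_kl(i, g) e_kl ⊗ e_{i0} ⊗ λ(g)`. -/
def colKernel (a : κ → κ → ℕ × G → ℂ) : κ × ℕ × G → κ × ℕ × G → ℂ :=
  fun p q => if q.2.1 = 0 then a p.1 q.1 (p.2.1, p.2.2 * q.2.2⁻¹) else 0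

/-- The matrix of `∑ a_kl(i, g) e_kl ⊗ e_{0i} ⊗ e_{1g}`. -/
def rowKernel (a : κ → κ → ℕ × G → ℂ) : κ × ℕ × G → κ × ℕ × G → ℂ :=
  fun p q => if p.2 = (0, 1) then a p.1 q.1 q.2 else 0

/-- The matrix-valued family `a` has norm at most `C` both in `C ⊗ C*_λ(G)` and in `R ⊗ R(G)`. -/
def InterBound (a : κ → κ → ℕ × G → ℂ) (C : ℝ) : Prop :=
  KernelBound (colKernel a) C ∧ KernelBound (rowKernel a) C

variable {a b : κ → κ → ℕ × G → ℂ} {C D : ℝ}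

theorem InterBound.add (ha : InterBound a C) (hb : InterBound b D) :
    InterBound (a + b) (C + D) := by
  constructor
  · convert ha.1.add hb.1 using 1
    ext p q
    by_cases h : q.2.1 = 0 <;> simp [colKernel, h]
  · convert ha.2.add hb.2 using 1
    ext p q
    by_cases h : p.2 = (0, 1) <;> simp [rowKernel, h]

theorem groupKernel_zero_col (hC : 0 ≤ C) (ha : InterBound a C) :
    KernelBound (groupKernel fun k l x => a k l (0, x)) C := by
  refine ha.1.compress hC Set.univ Set.univ (fun p => (p.1, 0, p.2)) (fun q => (q.1, 0, q.2))
    ?_ ?_ (fun p q _ _ => by simp [groupKernel, colKernel]) (by simp)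
  · rintro ⟨p1, p2⟩ - ⟨q1, q2⟩ - h
    simpa using h
  · rintro ⟨p1, p2⟩ - ⟨q1, q2⟩ - h
    simpa using h

/-- The row norm costs nothing: the coefficients reappear in the row of the group matrix at the
identity, with that of g in column g⁻¹. -/
theorem interBound_single_col {a : κ → κ → G → ℂ} (hC : 0 ≤ C)
    (ha : KernelBound (groupKernel a) C) :
    InterBound (fun k l (p : ℕ × G) => if p.1 = 0 then a k l p.2 else 0) C := by
  constructor
  · refine ha.compress hC {p | p.2.1 = 0} {q | q.2.1 = 0} (fun p => (p.1, p.2.2))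
      (fun q => (q.1, q.2.2)) ?_ ?_ ?_ ?_
    · rintro ⟨p1, p2, p3⟩ hp ⟨q1, q2, q3⟩ hq h
      simp_all
    · rintro ⟨p1, p2, p3⟩ hp ⟨q1, q2, q3⟩ hq h
      simp_all
    · intro p q hp hq
      simp_all [groupKernel, colKernel]
    · intro p q h
      simp only [Set.mem_ofPred_eq] at h
      simp only [colKernel]
      split_ifs <;> first | rfl | tauto
  · refine ha.compress hC {p | p.2 = (0, 1)} {q | q.2.1 = 0} (fun p => (p.1, 1))
      (fun q => (q.1, q.2.2⁻¹)) ?_ ?_ ?_ ?_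
    · rintro ⟨p1, p2, p3⟩ hp ⟨q1, q2, q3⟩ hq h
      simp_all
    · rintro ⟨p1, p2, p3⟩ hp ⟨q1, q2, q3⟩ hq h
      simp_all
    · intro p q hp hq
      simp_all [groupKernel, rowKernel]
    · intro p q h
      simp only [Set.mem_ofPred_eq] at h
      simp only [rowKernel]
      split_ifs <;> first | rfl | tauto

-- Injective relabelling only selects rows of the column matrix and columns of the row matrix. It
-- provides both the parity splitting and the shift of columns.
open Classical in
theorem InterBound.reindex (hC : 0 ≤ C) (ha : InterBound a C) {f : ℕ → ℕ} {S : Set ℕ}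
    (hf : Set.InjOn f S) :
    InterBound (fun k l p => if p.1 ∈ S then a k l (f p.1, p.2) else 0) C := by
  constructor
  · refine ha.1.compress hC {p | p.2.1 ∈ S} {q | q.2.1 = 0} (fun p => (p.1, f p.2.1, p.2.2))
      id ?_ (Set.injOn_id _) ?_ ?_
    · rintro ⟨p1, p2, p3⟩ hp ⟨q1, q2, q3⟩ hq h
      simp only [Prod.mk.injEq] at h ⊢
      exact ⟨h.1, hf hp hq h.2.1, h.2.2⟩
    · intro p q hp hq
      simp_all [colKernel]
    · intro p q h
      simp only [Set.mem_ofPred_eq] at h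
      simp only [colKernel]
      split_ifs <;> first | rfl | tauto
  · refine ha.2.compress hC {p | p.2 = (0, 1)} {q | q.2.1 ∈ S} id
      (fun q => (q.1, f q.2.1, q.2.2)) (Set.injOn_id _) ?_ ?_ ?_
    · rintro ⟨p1, p2, p3⟩ hp ⟨q1, q2, q3⟩ hq h
      simp only [Prod.mk.injEq] at h ⊢
      exact ⟨h.1, hf hp hq h.2.1, h.2.2⟩
    · intro p q hp hq
      simp_all [rowKernel]
    · intro p q h
      simp only [Set.mem_ofPred_eq] at h
      simp only [rowKernel]
      split_ifs <;> first | rfl | tauto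

end GroupKernels

/-! ### Haagerup-type estimates and the decomposition in the free group -/

section FreeGroupKernels

variable {κ : Type*} {C : ℝ}

/-- Restriction to the elements `g_i x`. -/
theorem interBound_comp_evenOdd {a : κ → κ → FreeGroup ℕ → ℂ} (hC : 0 ≤ C)
    (ha : KernelBound (groupKernel a) C) :
    InterBound (fun k l p => a k l (evenOdd p)) C := by
  constructor
  -- The coefficient at g_i x y⁻¹ is the group matrix entry in row g_i x and column y, so rows run
  -- over E and columns over the odd subgroup.
  · refine ha.compress hC Set.univ {q | q.2.1 = 0} (fun p => (p.1, evenOdd p.2))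
      (fun q => (q.1, oddHom q.2.2)) ?_ ?_ ?_ ?_
    · rintro ⟨p1, p2⟩ - ⟨q1, q2⟩ - h
      simpa [evenOdd_injective.eq_iff] using h
    · rintro ⟨p1, p2, p3⟩ hp ⟨q1, q2, q3⟩ hq h
      simp only [Set.mem_ofPred_eq] at hp hq
      simpa [oddHom_injective.eq_iff, hp, hq] using h
    · intro p q _ hq
      simp only [Set.mem_ofPred_eq] at hq
      simp [colKernel, groupKernel, hq, evenOdd, mul_assoc]
    · intro p q h
      simp only [Set.mem_ofPred_eq, Set.mem_univ, true_and] at h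
      simp [colKernel, h]
  -- The row of the identity, read at the columns (g_i x)⁻¹.
  · refine ha.compress hC {p | p.2 = (0, 1)} Set.univ (fun p => (p.1, 1))
      (fun q => (q.1, (evenOdd q.2)⁻¹)) ?_ ?_ ?_ ?_
    · rintro ⟨p1, p2⟩ hp ⟨q1, q2⟩ hq h
      simp_all
    · rintro ⟨p1, p2⟩ - ⟨q1, q2⟩ - h
      simpa [evenOdd_injective.eq_iff] using h
    · intro p q hp _
      simp only [Set.mem_ofPred_eq] at hp
      simp [rowKernel, groupKernel, hp]
    · intro p q h
      simp only [Set.mem_ofPred_eq, Set.mem_univ, and_true] at h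
      simp [rowKernel, h]

/-- The representative of the right coset of `t` modulo the odd subgroup on which `oddRetract` is
trivial. -/
def oddCoset (t : FreeGroup ℕ) : FreeGroup ℕ := (oddHom (oddRetract t))⁻¹ * t

theorem oddHom_mul_oddCoset (t : FreeGroup ℕ) : oddHom (oddRetract t) * oddCoset t = t := by
  simp [oddCoset]

theorem oddCoset_oddHom_mul (x t : FreeGroup ℕ) : oddCoset (oddHom x * t) = oddCoset t := by
  simp [oddCoset, oddRetract_oddHom, mul_assoc]

/-- Half of the index of the first letter. -/
def headIndex (t : FreeGroup ℕ) : ℕ := (t.toWord.headD (0, true)).1 / 2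

theorem headIndex_eq {t : FreeGroup ℕ} {i : ℕ} (h : t.toWord.head? = some (2 * i, true)) :
    headIndex t = i := by
  rw [headIndex, List.headD_eq_head?_getD, h]
  simp

/-- `t = g_i w` without cancellation and `t s⁻¹ = g_i x` for some `x` in the odd subgroup. -/
def CreatesHead (t s : FreeGroup ℕ) : Prop :=
  ∃ p, t.toWord.head? = some (2 * p.1, true) ∧ evenOdd p = t * s⁻¹

-- With t = g_i w, the condition on the entry is w = x s for some odd x: w and s share a right coset
-- of the odd subgroup. Inside a coset the entry depends only on i and the odd parts of w and s,
-- exactly as in the column matrix; the coset is the amplification index.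
open Classical in
theorem kernelBound_creation {a : κ → κ → ℕ × FreeGroup ℕ → ℂ} (hC : 0 ≤ C)
    (ha : KernelBound (colKernel a) C) :
    KernelBound (fun p q : κ × FreeGroup ℕ => if CreatesHead p.2 q.2 then
      Function.extend evenOdd (a p.1 q.1) 0 (p.2 * q.2⁻¹) else 0) C := by
  set w : FreeGroup ℕ → FreeGroup ℕ := fun t => (FreeGroup.of (2 * headIndex t))⁻¹ * t with hw
  refine ha.compress_amplify hC
    (A := {p | ∃ i, p.2.toWord.head? = some (2 * i, true)}) (B := Set.univ)
    (u := fun p => oddCoset (w p.2)) (v := fun q => oddCoset q.2)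
    (m := fun p => (p.1, headIndex p.2, oddRetract (w p.2)))
    (r := fun q => (q.1, 0, oddRetract q.2)) ?_ ?_ ?_ ?_
  · rintro ⟨k, t⟩ - ⟨l, s⟩ - h
    simp only [Prod.mk.injEq] at h
    obtain ⟨h1, rfl, h3, h4⟩ := h
    have h5 : w t = w s := by
      rw [← oddHom_mul_oddCoset (w t), h1, h4, oddHom_mul_oddCoset]
    simp only [hw, h3, mul_right_inj] at h5
    rw [h5]
  · rintro ⟨k, t⟩ - ⟨l, s⟩ - h
    simp only [Prod.mk.injEq, true_and] at h
    obtain ⟨h1, rfl, h4⟩ := h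
    rw [← oddHom_mul_oddCoset t, h1, h4, oddHom_mul_oddCoset]
  · rintro ⟨k, t⟩ ⟨l, s⟩ ⟨i, hi⟩ - h
    simp only at h hi
    -- Equal coset representatives cancel in w s⁻¹, leaving an element of the odd subgroup.
    have e : evenOdd (headIndex t, oddRetract (w t) * (oddRetract s)⁻¹) = t * s⁻¹ := by
      have h1 : oddHom (oddRetract (w t)) = w t * (oddCoset s)⁻¹ := by
        rw [← h, eq_mul_inv_iff_mul_eq, oddHom_mul_oddCoset]
      have h2 : oddHom (oddRetract s) = s * (oddCoset s)⁻¹ := by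
        rw [eq_mul_inv_iff_mul_eq, oddHom_mul_oddCoset]
      simp only [evenOdd, map_mul, map_inv, h1, h2]
      simp [hw, mul_assoc]
    have hc : CreatesHead t s := ⟨_, by rw [hi, headIndex_eq hi], e⟩
    simp only [if_pos hc, colKernel, if_true]
    rw [← e, evenOdd_injective.extend_apply]
  · rintro ⟨k, t⟩ ⟨l, s⟩ h
    rw [if_neg]
    rintro ⟨p, h1, h2⟩
    refine h ⟨⟨p.1, h1⟩, trivial, ?_⟩
    have : w t = oddHom p.2 * s := by
      simp only at h1 h2
      simp only [hw, headIndex_eq h1, inv_mul_eq_iff_eq_mul, ← mul_assoc]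
      rw [← eq_mul_inv_iff_mul_eq.mp h2]
      simp [evenOdd]
    simp only [this, oddCoset_oddHom_mul]

-- Here `evenOdd_inv_mul_inj` recovers (i, x) and t from s, so each s meets at most one t. The
-- entries therefore come from the row matrix amplified by t.
open Classical in
theorem kernelBound_annihilation {a : κ → κ → ℕ × FreeGroup ℕ → ℂ} (hC : 0 ≤ C)
    (ha : KernelBound (rowKernel a) C) :
    KernelBound (fun p q : κ × FreeGroup ℕ => if CreatesHead p.2 q.2 then 0 else
      Function.extend evenOdd (a p.1 q.1) 0 (p.2 * q.2⁻¹)) C := by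
  set R : FreeGroup ℕ → (ℕ × FreeGroup ℕ) × FreeGroup ℕ → Prop := fun s x =>
    x.2.toWord.head? ≠ some (2 * x.1.1, true) ∧ s = (evenOdd x.1)⁻¹ * x.2 with hR
  have huniq : ∀ s x y, R s x → R s y → x = y := fun s x y hx hy =>
    Prod.ext_iff.mpr (evenOdd_inv_mul_inj hx.1 hy.1 (hx.2.symm.trans hy.2))
  -- The choice is arbitrary when s has no such decomposition; those s lie outside `B`.
  set f : FreeGroup ℕ → (ℕ × FreeGroup ℕ) × FreeGroup ℕ := fun s => Classical.epsilon (R s) with hf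
  have hfR : ∀ s, (∃ x, R s x) → R s (f s) := fun s h => Classical.epsilon_spec h
  refine ha.compress_amplify hC (A := Set.univ) (B := {q | ∃ x, R q.2 x})
    (u := fun p => p.2) (v := fun q => (f q.2).2)
    (m := fun p => (p.1, 0, 1)) (r := fun q => (q.1, (f q.2).1)) ?_ ?_ ?_ ?_
  · rintro ⟨k, t⟩ - ⟨l, s⟩ - h
    simpa [and_comm] using h
  · rintro ⟨k, t⟩ ht ⟨l, s⟩ hs h
    simp only [Prod.mk.injEq] at h
    obtain ⟨h1, rfl, h3⟩ := h
    rw [(hfR t ht).2, (hfR s hs).2, h1, h3]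
  · rintro ⟨k, t⟩ ⟨l, s⟩ - hs h
    simp only at h hs
    obtain ⟨h1, h2⟩ := hfR s hs
    have e : evenOdd (f s).1 = t * s⁻¹ := by
      conv_rhs => rw [h2, h]
      simp
    rw [if_neg]
    · simp only [rowKernel, if_true]
      rw [← e, evenOdd_injective.extend_apply]
    · rintro ⟨p, h3, h4⟩
      rw [← e, evenOdd_injective.eq_iff] at h4
      rw [← h, ← h4] at h1
      exact h1 h3
  · rintro ⟨k, t⟩ ⟨l, s⟩ h
    simp only
    split_ifs with hc
    · rfl
    · by_cases hx : ∃ p, evenOdd p = t * s⁻¹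
      · obtain ⟨p, hp⟩ := hx
        have hRp : R s (p, t) := ⟨fun hh => hc ⟨p, hh, hp⟩, by rw [hp]; simp⟩
        exact absurd ⟨trivial, ⟨_, hRp⟩, by rw [← huniq s _ _ hRp (hfR s ⟨_, hRp⟩)]⟩ h
      · rw [Function.extend_apply' _ _ _ hx]
        rfl

/-- Haagerup type inequality for families supported by the elements `g_i x`. -/
theorem kernelBound_extend_evenOdd {a : κ → κ → ℕ × FreeGroup ℕ → ℂ} (hC : 0 ≤ C)
    (ha : InterBound a C) :
    KernelBound (groupKernel fun k l => Function.extend evenOdd (a k l) 0) (C + C) := by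
  classical
  convert (kernelBound_creation hC ha.1).add (kernelBound_annihilation hC ha.2) using 1
  ext p q
  by_cases h : CreatesHead p.2 q.2 <;> simp [groupKernel, h]

/-- The complement of the restriction to the elements `g_i x`. -/
theorem kernelBound_sub_evenOdd {a : κ → κ → FreeGroup ℕ → ℂ} (hC : 0 ≤ C)
    (ha : KernelBound (groupKernel a) C) :
    KernelBound (groupKernel fun k l =>
      a k l - Function.extend evenOdd (fun p => a k l (evenOdd p)) 0) (C + (C + C)) := by
  have h := ha.sub (kernelBound_extend_evenOdd hC (interBound_comp_evenOdd hC ha))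
  intro s t η ξ
  simpa only [groupKernel, Pi.sub_apply] using h s t η ξ

/-! ### The bijection of the index sets -/

/-- `(0, x) ↦ x` if `x` is not of the form `g_i y`, `(0, g_i y) ↦ g_{2i} y`,
`(i + 1, x) ↦ g_{2i+1} x`. -/
def indexFun : ℕ × FreeGroup ℕ → FreeGroup ℕ
  | (0, x) => (Function.partialInv evenOdd x).elim x fun p => evenOdd (2 * p.1, p.2)
  | (i + 1, x) => evenOdd (2 * i + 1, x)

/-- The inverse of `indexFun`. -/
def indexInv (x : FreeGroup ℕ) : ℕ × FreeGroup ℕ :=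
  (Function.partialInv evenOdd x).elim (0, x) fun p =>
    if p.1 % 2 = 0 then (0, evenOdd (p.1 / 2, p.2)) else (p.1 / 2 + 1, p.2)

theorem partialInv_evenOdd (p : ℕ × FreeGroup ℕ) :
    Function.partialInv evenOdd (evenOdd p) = some p :=
  Function.partialInv_left evenOdd_injective p

theorem partialInv_evenOdd_eq_none {x : FreeGroup ℕ} (h : ¬ ∃ p, evenOdd p = x) :
    Function.partialInv evenOdd x = none := by
  rw [Function.partialInv, dif_neg h]

/-- The bijection `ℕ × F → F` that induces the complete isomorphism. -/
def indexEquiv : ℕ × FreeGroup ℕ ≃ FreeGroup ℕ where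
  toFun := indexFun
  invFun := indexInv
  left_inv := by
    rintro ⟨_ | i, x⟩
    · by_cases h : ∃ p, evenOdd p = x
      · obtain ⟨p, rfl⟩ := h
        simp [indexFun, indexInv, partialInv_evenOdd]
      · simp [indexFun, indexInv, partialInv_evenOdd_eq_none h]
    · have h : (2 * i + 1) / 2 = i := by omega
      simp [indexFun, indexInv, partialInv_evenOdd, h]
  right_inv := by
    intro x
    by_cases h : ∃ p, evenOdd p = x
    · obtain ⟨⟨i, y⟩, rfl⟩ := h
      rcases Nat.mod_two_eq_zero_or_one i with hi | hi
      · have : 2 * (i / 2) = i := by omega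
        simp [indexFun, indexInv, partialInv_evenOdd, hi, this]
      · have : 2 * (i / 2) + 1 = i := by omega
        simp [indexFun, indexInv, partialInv_evenOdd, hi, this]
    · simp [indexFun, indexInv, partialInv_evenOdd_eq_none h]

/-- The constant is 3 + 2 + 1: the part off E stays in column 0, the g_i x with i even are
re-extended into column 0, and those with i odd fill the remaining columns. -/
theorem interBound_indexEquiv {a : κ → κ → FreeGroup ℕ → ℂ} (hC : 0 ≤ C)
    (ha : KernelBound (groupKernel a) C) :
    InterBound (fun k l p => a k l (indexEquiv p)) (6 * C) := by
  classical
  have hs := interBound_comp_evenOdd hC ha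
  have h1 := interBound_single_col (by linarith) (kernelBound_sub_evenOdd hC ha)
  have h2 := interBound_single_col (by linarith) (kernelBound_extend_evenOdd hC
    (hs.reindex hC (f := fun i => 2 * i) (S := Set.univ) fun i _ j _ h => by simpa using h))
  -- Column 0 is excluded: truncated subtraction would give it the same image as column 1.
  have h3 := hs.reindex hC (f := fun i => 2 * (i - 1) + 1) (S := {i | i ≠ 0})
    fun i (hi : i ≠ 0) j (hj : j ≠ 0) h => by
      simp only at h
      omega
  convert (h1.add h2).add h3 using 1
  · ext k l ⟨_ | i, x⟩
    · by_cases h : ∃ p, evenOdd p = x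
      · obtain ⟨p, rfl⟩ := h
        simp [indexEquiv, indexFun, partialInv_evenOdd, evenOdd_injective.extend_apply]
      · simp [indexEquiv, indexFun, partialInv_evenOdd_eq_none h, Function.extend_apply' _ _ _ h]
    · simp [indexEquiv, indexFun]
  · ring

/-- The constant is 3 + 2 + 2: column 0 gives its part off E and its part on E, the latter moved to
even i; the other columns are extended from odd i. -/
theorem kernelBound_indexEquiv_symm {a : κ → κ → ℕ × FreeGroup ℕ → ℂ} (hC : 0 ≤ C)
    (ha : InterBound a C) :
    KernelBound (groupKernel fun k l x => a k l (indexEquiv.symm x)) (7 * C) := by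
  classical
  have h0 := groupKernel_zero_col hC ha
  have hs := interBound_comp_evenOdd hC h0
  have h1 := kernelBound_sub_evenOdd hC h0
  have h2 := kernelBound_extend_evenOdd hC
    (hs.reindex hC (f := fun i => i / 2) (S := {i | i % 2 = 0})
      fun i (hi : i % 2 = 0) j (hj : j % 2 = 0) h => by
        simp only at h
        omega)
  have h3 := kernelBound_extend_evenOdd hC
    (ha.reindex hC (f := fun i => i / 2 + 1) (S := {i | i % 2 = 1})
      fun i (hi : i % 2 = 1) j (hj : j % 2 = 1) h => by
        simp only at h
        omega)
  convert (h1.add h2).add h3 using 1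
  · ext p q
    simp only [groupKernel, Pi.add_apply, Pi.sub_apply]
    generalize p.2 * q.2⁻¹ = x
    by_cases h : ∃ p, evenOdd p = x
    · obtain ⟨⟨i, y⟩, rfl⟩ := h
      rcases Nat.mod_two_eq_zero_or_one i with hi | hi <;>
        simp [indexEquiv, indexInv, partialInv_evenOdd, evenOdd_injective.extend_apply, hi]
    · simp [indexEquiv, indexInv, partialInv_evenOdd_eq_none h, Function.extend_apply' _ _ _ h]
  · ring

end FreeGroupKernels

/-! ### Operators and their matrices -/

section Matrices

variable {H K : Type*} [NormedAddCommGroup H] [InnerProductSpace ℂ H]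
  [NormedAddCommGroup K] [InnerProductSpace ℂ K] {I J : Type*}

/-- Only the zero vector is orthogonal to the family `b`. -/
def IsTotal (b : I → H) : Prop := ∀ x, (∀ i, inner ℂ (b i) x = 0) → x = 0

theorem IsTotal.dense_span [CompleteSpace H] {b : I → H} (hb : IsTotal b) :
    Dense (Submodule.span ℂ (Set.range b) : Set H) := by
  rw [Submodule.dense_iff_topologicalClosure_eq_top, Submodule.topologicalClosure_eq_top_iff,
    Submodule.eq_bot_iff]
  exact fun x hx => hb x fun i => hx _ (Submodule.subset_span ⟨i, rfl⟩)

theorem norm_sum_smul_orthonormal {b : I → H} (hb : Orthonormal ℂ b) (s : Finset I) (f : I → ℂ) :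
    ‖∑ i ∈ s, f i • b i‖ = √(∑ i ∈ s, ‖f i‖ ^ 2) := by
  rw [@norm_eq_sqrt_re_inner ℂ, hb.inner_sum]
  congr 1
  simp only [RCLike.conj_mul, map_sum]
  exact Finset.sum_congr rfl fun i _ => by norm_cast

theorem sum_inner_eq (B : H →L[ℂ] H) (b : I → H) (s t : Finset I) (η ξ : I → ℂ) :
    ∑ p ∈ s, ∑ q ∈ t, η p * inner ℂ (b p) (B (b q)) * ξ q
      = inner ℂ (∑ p ∈ s, star (η p) • b p) (B (∑ q ∈ t, ξ q • b q)) := by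
  rw [sum_inner]
  refine Finset.sum_congr rfl fun p _ => ?_
  rw [map_sum, inner_sum]
  refine Finset.sum_congr rfl fun q _ => ?_
  rw [map_smul, inner_smul_left, inner_smul_right]
  simp
  ring

theorem kernelBound_inner {b : I → H} (hb : Orthonormal ℂ b) (B : H →L[ℂ] H) :
    KernelBound (fun i j => inner ℂ (b i) (B (b j))) ‖B‖ := by
  intro s t η ξ
  rw [sum_inner_eq]
  refine (norm_inner_le_norm _ _).trans ?_
  rw [mul_comm ‖B‖, mul_assoc]
  refine mul_le_mul (le_of_eq ?_) ((B.le_opNorm _).trans (le_of_eq ?_)) (norm_nonneg _)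
    (Real.sqrt_nonneg _)
  · simp [norm_sum_smul_orthonormal hb]
  · rw [norm_sum_smul_orthonormal hb]

/-- The bound on the sesquilinear form extends from the dense span to all pairs, and is then tested
at (Bx, x). -/
theorem norm_le_of_kernelBound [CompleteSpace H] {b : I → H} (hb : Orthonormal ℂ b)
    (hb' : IsTotal b) (B : H →L[ℂ] H) {C : ℝ} (hC : 0 ≤ C)
    (h : KernelBound (fun i j => inner ℂ (b i) (B (b j))) C) : ‖B‖ ≤ C := by
  have hd := hb'.dense_span
  have key : ∀ p : H × H, ‖inner ℂ p.1 (B p.2)‖ ≤ C * ‖p.1‖ * ‖p.2‖ := by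
    refine isClosed_property (hd.denseRange_val.prodMap hd.denseRange_val)
      (isClosed_le (by fun_prop) (by fun_prop)) ?_
    rintro ⟨⟨y, hy⟩, ⟨x, hx⟩⟩
    obtain ⟨f, rfl⟩ := Finsupp.mem_span_range_iff_exists_finsupp.mp hy
    obtain ⟨g, rfl⟩ := Finsupp.mem_span_range_iff_exists_finsupp.mp hx
    have := h f.support g.support (fun i => star (f i)) g
    rw [sum_inner_eq] at this
    simpa [Finsupp.sum, norm_sum_smul_orthonormal hb] using this
  refine B.opNorm_le_bound hC fun x => ?_
  have h1 := key (B x, x)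
  simp only [inner_self_eq_norm_sq_to_K] at h1
  rcases (norm_nonneg (B x)).eq_or_lt with h0 | h0
  · rw [← h0]
    positivity
  · refine le_of_mul_le_mul_right ?_ h0
    have h2 : ‖B x‖ * ‖B x‖ ≤ C * ‖B x‖ * ‖x‖ := by simpa [sq] using h1
    linarith

/-- The orthonormal family of `ℓ₂ⁿ(H)` induced by a family in `H`. -/
def blockVec (b : I → H) {n : ℕ} (p : Fin n × I) : PiLp 2 (fun _ : Fin n => H) :=
  WithLp.toLp 2 (Pi.single p.1 (b p.2))

theorem inner_blockVec (b : I → H) {n : ℕ} (p : Fin n × I) (x : PiLp 2 (fun _ : Fin n => H)) :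
    inner ℂ (blockVec b p) x = inner ℂ (b p.2) (x p.1) := by
  rw [PiLp.inner_apply, Finset.sum_eq_single p.1]
  · simp [blockVec]
  · intro k _ hk
    simp [blockVec, hk]
  · simp

theorem orthonormal_blockVec {b : I → H} (hb : Orthonormal ℂ b) (n : ℕ) :
    Orthonormal ℂ (blockVec b : Fin n × I → _) := by
  classical
  rw [orthonormal_iff_ite] at hb ⊢
  rintro ⟨k, i⟩ ⟨l, j⟩
  rw [inner_blockVec]
  by_cases hkl : k = l
  · subst hkl
    simp [blockVec, hb]
  · simp [blockVec, hkl]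

theorem isTotal_blockVec {b : I → H} (hb : IsTotal b) (n : ℕ) :
    IsTotal (blockVec b : Fin n × I → _) := by
  intro x hx
  ext k
  exact hb _ fun i => by rw [← inner_blockVec b (k, i)]; exact hx _

theorem inner_blockOp (b : I → H) {n : ℕ} (T : Matrix (Fin n) (Fin n) (H →L[ℂ] H))
    (p q : Fin n × I) :
    inner ℂ (blockVec b p) (blockOp T (blockVec b q)) = inner ℂ (b p.2) (T p.1 q.1 (b q.2)) := by
  rw [inner_blockVec, blockOp_apply, Finset.sum_eq_single q.1]
  · simp [blockVec]
  · intro k _ hk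
    simp [blockVec, hk]
  · simp

theorem norm_blockOp_le [CompleteSpace H] {b : I → H} (hb : Orthonormal ℂ b) (hb' : IsTotal b)
    {n : ℕ} (T : Matrix (Fin n) (Fin n) (H →L[ℂ] H)) {C : ℝ} (hC : 0 ≤ C)
    (h : KernelBound (fun p q : Fin n × I => inner ℂ (b p.2) (T p.1 q.1 (b q.2))) C) :
    ‖blockOp T‖ ≤ C := by
  refine norm_le_of_kernelBound (orthonormal_blockVec hb n) (isTotal_blockVec hb' n) _ hC ?_
  simpa only [inner_blockOp] using h

theorem kernelBound_blockOp {b : I → H} (hb : Orthonormal ℂ b)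
    {n : ℕ} (T : Matrix (Fin n) (Fin n) (H →L[ℂ] H)) :
    KernelBound (fun p q : Fin n × I => inner ℂ (b p.2) (T p.1 q.1 (b q.2))) ‖blockOp T‖ := by
  simpa only [inner_blockOp] using kernelBound_inner (orthonormal_blockVec hb n) (blockOp T)

/-- The orthonormal family of `H ⊕ K` induced by families in `H` and `K`. -/
def sumVec (b : I → H) (c : J → K) : I ⊕ J → WithLp 2 (H × K) :=
  Sum.elim (fun i => WithLp.toLp 2 (b i, 0)) (fun j => WithLp.toLp 2 (0, c j))

theorem orthonormal_sumVec {b : I → H} {c : J → K} (hb : Orthonormal ℂ b)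
    (hc : Orthonormal ℂ c) : Orthonormal ℂ (sumVec b c) := by
  classical
  rw [orthonormal_iff_ite] at hb hc ⊢
  rintro (i | i) (j | j) <;> simp [sumVec, hb, hc]

theorem isTotal_sumVec {b : I → H} {c : J → K} (hb : IsTotal b)
    (hc : IsTotal c) : IsTotal (sumVec b c) := by
  intro x hx
  have h1 : x.fst = 0 := hb _ fun i => by simpa [sumVec] using hx (.inl i)
  have h2 : x.snd = 0 := hc _ fun i => by simpa [sumVec] using hx (.inr i)
  apply (WithLp.equiv 2 (H × K)).injective
  exact Prod.ext h1 h2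

theorem norm_le_norm_diagOp (S : H →L[ℂ] H) (T : K →L[ℂ] K) :
    ‖S‖ ≤ ‖diagOp (S, T)‖ ∧ ‖T‖ ≤ ‖diagOp (S, T)‖ := by
  constructor
  · refine S.opNorm_le_bound (diagOp (S, T)).opNorm_nonneg fun x => ?_
    simpa [diagOp_apply] using (diagOp (S, T)).le_opNorm (WithLp.toLp 2 (x, 0))
  · refine T.opNorm_le_bound (diagOp (S, T)).opNorm_nonneg fun x => ?_
    simpa [diagOp_apply] using (diagOp (S, T)).le_opNorm (WithLp.toLp 2 (0, x))

theorem norm_diagOp_le (S : H →L[ℂ] H) (T : K →L[ℂ] K) :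
    ‖diagOp (S, T)‖ ≤ max ‖S‖ ‖T‖ := by
  have hm : 0 ≤ max ‖S‖ ‖T‖ := le_max_of_le_left (norm_nonneg _)
  refine ContinuousLinearMap.opNorm_le_bound _ hm fun x => ?_
  refine le_of_sq_le_sq ?_ (by positivity)
  rw [diagOp_apply, mul_pow, WithLp.prod_norm_sq_eq_of_L2, WithLp.prod_norm_sq_eq_of_L2, mul_add]
  refine add_le_add ?_ ?_ <;> rw [← mul_pow] <;> refine pow_le_pow_left₀ (norm_nonneg _) ?_ 2
  · exact (S.le_opNorm _).trans (mul_le_mul_of_nonneg_right (le_max_left _ _) (norm_nonneg _))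
  · exact (T.le_opNorm _).trans (mul_le_mul_of_nonneg_right (le_max_right _ _) (norm_nonneg _))

end Matrices

/-! ### Bases of the Hilbert spaces at hand -/

section Bases

theorem orthonormal_bvec (ι : Type*) [DecidableEq ι] : Orthonormal ℂ (bvec : ι → L2 ι) := by
  rw [orthonormal_iff_ite]
  exact inner_bvec

theorem isTotal_bvec (ι : Type*) [DecidableEq ι] : IsTotal (bvec : ι → L2 ι) := by
  intro x hx
  ext i
  simpa [bvec, lp.inner_single_left] using hx i

variable {ι ι' : Type*} [DecidableEq ι] [DecidableEq ι']

theorem clm_eq_zero_of_bvec (f : L2 ι →L[ℂ] ℂ) (hf : ∀ i, f (bvec i) = 0) : f = 0 := by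
  refine ContinuousLinearMap.ext_on (isTotal_bvec ι).dense_span ?_
  rintro _ ⟨i, rfl⟩
  simpa using hf i

/-- The orthonormal basis `e_i ⊗ e_j` of `ℓ₂(ι) ⊗₂ ℓ₂(ι')`. -/
def tensorVec (p : ι × ι') : HTensor (L2 ι) (L2 ι') := vecTensor (bvec p.1) (bvec p.2)

theorem inner_vecTensor {H K : Type*} [NormedAddCommGroup H] [InnerProductSpace ℂ H]
    [NormedAddCommGroup K] [InnerProductSpace ℂ K] (ξ ξ' : H) (η η' : K) :
    inner ℂ (vecTensor ξ η) (vecTensor ξ' η') = inner ℂ ξ ξ' * inner ℂ η η' := by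
  simp [vecTensor]

theorem inner_tensorVec (p q : ι × ι') :
    inner ℂ (tensorVec p) (tensorVec q) = if p = q then (1 : ℂ) else 0 := by
  rw [tensorVec, tensorVec, inner_vecTensor, inner_bvec, inner_bvec]
  by_cases h1 : p.1 = q.1 <;> by_cases h2 : p.2 = q.2 <;> simp [h1, h2, Prod.ext_iff]

theorem orthonormal_tensorVec :
    Orthonormal ℂ (tensorVec : ι × ι' → HTensor (L2 ι) (L2 ι')) := by
  rw [orthonormal_iff_ite]
  exact inner_tensorVec

theorem isTotal_tensorVec :
    IsTotal (tensorVec : ι × ι' → HTensor (L2 ι) (L2 ι')) := by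
  intro x hx
  -- The functional ⟨x, ·⟩ is killed on elementary tensors one variable at a time, hence on the
  -- completion, and in particular at x.
  set f : L2 ι ⊗[ℂ] L2 ι' →L[ℂ] ℂ := innerSL ℂ x ∘L UniformSpace.Completion.toComplL with hf
  have hf0 : ∀ i j, f (bvec i ⊗ₜ bvec j) = 0 := fun i j => by
    have := hx (i, j)
    rw [← inner_conj_symm, map_eq_zero] at this
    exact this
  have h1 : ∀ j, f ∘L (TensorProduct.mkL ℂ (L2 ι) (L2 ι')).flip (bvec j) = 0 := fun j =>
    clm_eq_zero_of_bvec _ fun i => hf0 i j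
  have h2 : ∀ ξ, f ∘L TensorProduct.mkL ℂ (L2 ι) (L2 ι') ξ = 0 := fun ξ =>
    clm_eq_zero_of_bvec _ fun j => DFunLike.congr_fun (h1 j) ξ
  have h3 : ∀ z, f z = 0 := fun z => by
    induction z using TensorProduct.induction_on with
    | zero => exact map_zero f
    | tmul ξ η => exact DFunLike.congr_fun (h2 ξ) η
    | add u v hu hv => rw [map_add, hu, hv, add_zero]
  have h4 : ∀ z : HTensor (L2 ι) (L2 ι'), inner ℂ x z = 0 := fun z => by
    induction z using UniformSpace.Completion.induction_on with
    | hp => exact isClosed_eq (by fun_prop) continuous_const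
    | ih z => exact h3 z
  exact inner_self_eq_zero.mp (h4 x)

end Bases

/-! ### Complete isomorphisms defined on dense subspaces -/

section Extension

variable {H K : Type*} [NormedAddCommGroup H] [InnerProductSpace ℂ H]
  [NormedAddCommGroup K] [InnerProductSpace ℂ K] {V : Type*} [AddCommGroup V] [Module ℂ V]

theorem norm_entry_le (n : ℕ) (T : Matrix (Fin n) (Fin n) (H →L[ℂ] H)) (i j : Fin n) :
    ‖T i j‖ ≤ ‖blockOp T‖ := by
  refine (T i j).opNorm_le_bound (blockOp T).opNorm_nonneg fun x => ?_
  have h := (PiLp.norm_apply_le (blockOp T (WithLp.toLp 2 (Pi.single j x))) i).trans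
    ((blockOp T).le_opNorm _)
  rw [blockOp_apply, Finset.sum_eq_single j (fun k _ hk => by simp [hk]) (by simp)] at h
  simpa using h

theorem norm_blockOp_one (T : Matrix (Fin 1) (Fin 1) (H →L[ℂ] H)) : ‖blockOp T‖ = ‖T 0 0‖ := by
  refine le_antisymm ?_ (norm_entry_le 1 T 0 0)
  refine (blockOp T).opNorm_le_bound (T 0 0).opNorm_nonneg fun x => ?_
  simpa [PiLp.norm_eq_of_L2, blockOp_apply] using (T 0 0).le_opNorm (x 0)

theorem continuous_norm_sum_comp {E Ω : Type*} [NormedAddCommGroup E] [NormedSpace ℂ E]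
    [TopologicalSpace Ω] {n : ℕ} (A : Fin n → H →L[ℂ] E) (B : Fin n → E →L[ℂ] H)
    {f : Ω → Matrix (Fin n) (Fin n) (H →L[ℂ] H)} (hf : ∀ i j, Continuous fun ω => f ω i j) :
    Continuous fun ω => ‖∑ i, ∑ j, A i ∘L f ω i j ∘L B j‖ := by
  refine (continuous_finsetSum _ fun i _ => continuous_finsetSum _ fun j _ => ?_).norm
  exact continuous_const.clm_comp ((hf i j).clm_comp continuous_const)

/-- The block operator is a finite sum of its entries composed with fixed inclusions and
projections. -/
theorem continuous_norm_blockOp {Ω : Type*} [TopologicalSpace Ω] {n : ℕ}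
    {f : Ω → Matrix (Fin n) (Fin n) (H →L[ℂ] H)} (hf : ∀ i j, Continuous fun ω => f ω i j) :
    Continuous fun ω => ‖blockOp (f ω)‖ := by
  convert continuous_norm_sum_comp (fun i =>
    (PiLp.continuousLinearEquiv 2 ℂ (fun _ : Fin n => H)).symm.toContinuousLinearMap ∘L
        ContinuousLinearMap.single ℂ (fun _ : Fin n => H) i)
    (fun j => PiLp.proj 2 (𝕜 := ℂ) (fun _ : Fin n => H) j) hf using 3 with ω
  ext x k
  rw [blockOp_apply]
  simp [Pi.single_apply]

theorem denseRange_codRestrict_topologicalClosure {E : Type*} [TopologicalSpace E]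
    [AddCommGroup E] [Module ℂ E] [IsTopologicalAddGroup E] [ContinuousSMul ℂ E] (α : V →ₗ[ℂ] E) :
    DenseRange (α.codRestrict (LinearMap.range α).topologicalClosure
      fun v => Submodule.le_topologicalClosure _ (LinearMap.mem_range_self α v)) := by
  intro x
  rw [closure_subtype]
  refine closure_mono ?_ x.2
  rintro _ ⟨v, rfl⟩
  exact ⟨_, ⟨v, rfl⟩, rfl⟩

/-- For each fixed n the inequality is a closed condition on the entries, so it need only be checked
on a dense set of matrices. -/
theorem completelyBounded_of_dense {X : Submodule ℂ (H →L[ℂ] H)} {Y : Submodule ℂ (K →L[ℂ] K)}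
    {e₁ : V →ₗ[ℂ] X} {e₂ : V →ₗ[ℂ] Y} (h₁ : DenseRange e₁) (u : X →L[ℂ] Y)
    (hu : ∀ v, u (e₁ v) = e₂ v) {c : ℝ}
    (h : ∀ (n : ℕ) (T : Matrix (Fin n) (Fin n) V),
      matNorm Y (T.map e₂) ≤ c * matNorm X (T.map e₁)) :
    CompletelyBounded (u : X →ₗ[ℂ] Y) := by
  refine ⟨c, fun n T => ?_⟩
  have hd : DenseRange fun (M : Fin n → Fin n → V) i j => e₁ (M i j) :=
    DenseRange.piMap fun _ => DenseRange.piMap fun _ => h₁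
  refine isClosed_property (p := fun T : Fin n → Fin n → X =>
    matNorm Y (Matrix.map (Matrix.of T) u) ≤ c * matNorm X (Matrix.of T)) hd
    (isClosed_le ?_ (continuous_const.mul ?_)) (fun M => ?_) T
  · exact continuous_norm_blockOp fun i j =>
      continuous_subtype_val.comp (u.continuous.comp (continuous_apply_apply i j))
  · exact continuous_norm_blockOp fun i j =>
      continuous_subtype_val.comp (continuous_apply_apply i j)
  · have e : Matrix.map (Matrix.of fun i j => e₁ (M i j)) u = (Matrix.of M).map e₂ :=
      Matrix.ext fun i j => hu _
    simp only [e]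
    exact h n (Matrix.of M)

theorem exists_equiv_of_denseRange {E F : Type*} [NormedAddCommGroup E] [NormedSpace ℂ E]
    [NormedAddCommGroup F] [NormedSpace ℂ F] {X : Submodule ℂ E} {Y : Submodule ℂ F}
    [CompleteSpace X] [CompleteSpace Y] {e₁ : V →ₗ[ℂ] X} {e₂ : V →ₗ[ℂ] Y} (h₁ : DenseRange e₁)
    (h₂ : DenseRange e₂) {c d : ℝ} (b₁ : ∀ v, ‖(e₂ v : F)‖ ≤ c * ‖(e₁ v : E)‖)
    (b₂ : ∀ v, ‖(e₁ v : E)‖ ≤ d * ‖(e₂ v : F)‖) :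
    ∃ u : X ≃L[ℂ] Y, (∀ v, u (e₁ v) = e₂ v) ∧ ∀ v, u.symm (e₂ v) = e₁ v :=
  ⟨LinearEquiv.extend (LinearEquiv.refl ℂ V) e₁ e₂ h₁ ⟨c, b₁⟩ h₂ ⟨d, b₂⟩,
    LinearEquiv.extend_eq (LinearEquiv.refl ℂ V) e₁ e₂ h₁ ⟨c, b₁⟩ h₂ ⟨d, b₂⟩,
    LinearEquiv.extend_symm_eq (LinearEquiv.refl ℂ V) e₁ e₂ h₁ ⟨c, b₁⟩ h₂ ⟨d, b₂⟩⟩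

theorem completelyIsomorphic_of_denseRange {X : Submodule ℂ (H →L[ℂ] H)}
    {Y : Submodule ℂ (K →L[ℂ] K)} [CompleteSpace X] [CompleteSpace Y]
    {e₁ : V →ₗ[ℂ] X} {e₂ : V →ₗ[ℂ] Y} (h₁ : DenseRange e₁) (h₂ : DenseRange e₂) {c d : ℝ}
    (h : ∀ (n : ℕ) (T : Matrix (Fin n) (Fin n) V),
      matNorm Y (T.map e₂) ≤ c * matNorm X (T.map e₁))
    (h' : ∀ (n : ℕ) (T : Matrix (Fin n) (Fin n) V),
      matNorm X (T.map e₁) ≤ d * matNorm Y (T.map e₂)) :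
    CompletelyIsomorphic X Y := by
  -- The case n = 1 gives the norm estimates needed to extend the maps.
  have b₁ : ∀ v, ‖(e₂ v : K →L[ℂ] K)‖ ≤ c * ‖(e₁ v : H →L[ℂ] H)‖ := fun v => by
    have := h 1 (Matrix.of fun _ _ => v)
    rw [matNorm, matNorm, norm_blockOp_one, norm_blockOp_one] at this
    exact this
  have b₂ : ∀ v, ‖(e₁ v : H →L[ℂ] H)‖ ≤ d * ‖(e₂ v : K →L[ℂ] K)‖ := fun v => by
    have := h' 1 (Matrix.of fun _ _ => v)
    rw [matNorm, matNorm, norm_blockOp_one, norm_blockOp_one] at this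
    exact this
  obtain ⟨u, hu, hu'⟩ := exists_equiv_of_denseRange h₁ h₂ b₁ b₂
  exact ⟨u.toLinearEquiv, completelyBounded_of_dense h₁ u.toContinuousLinearMap hu h,
    completelyBounded_of_dense h₂ u.symm.toContinuousLinearMap hu' h'⟩

theorem completelyIsomorphic_closure_range [CompleteSpace H] [CompleteSpace K]
    (α : V →ₗ[ℂ] H →L[ℂ] H) (β : V →ₗ[ℂ] K →L[ℂ] K) {c d : ℝ}
    (h : ∀ (n : ℕ) (T : Matrix (Fin n) (Fin n) V),
      ‖blockOp (T.map β)‖ ≤ c * ‖blockOp (T.map α)‖)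
    (h' : ∀ (n : ℕ) (T : Matrix (Fin n) (Fin n) V),
      ‖blockOp (T.map α)‖ ≤ d * ‖blockOp (T.map β)‖) :
    CompletelyIsomorphic (LinearMap.range α).topologicalClosure
      (LinearMap.range β).topologicalClosure :=
  completelyIsomorphic_of_denseRange (denseRange_codRestrict_topologicalClosure α)
    (denseRange_codRestrict_topologicalClosure β) h h'

end Extension

/-! ### The intersection space as the closure of the finitely supported families -/

section Density

section OpTensor

variable {H K : Type*} [NormedAddCommGroup H] [InnerProductSpace ℂ H]
  [NormedAddCommGroup K] [InnerProductSpace ℂ K]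

theorem opTensor_coe (S : H →L[ℂ] H) (T : K →L[ℂ] K) (z : H ⊗[ℂ] K) :
    opTensor S T (z : HTensor H K) = (TensorProduct.mapL S T z : H ⊗[ℂ] K) := by
  simp [opTensor]

theorem clm_hTensor_ext {A B : HTensor H K →L[ℂ] HTensor H K}
    (h : ∀ z : H ⊗[ℂ] K, A (z : HTensor H K) = B (z : HTensor H K)) : A = B := by
  ext x
  induction x using UniformSpace.Completion.induction_on with
  | hp => exact isClosed_eq A.continuous B.continuous
  | ih z => exact h z

theorem norm_opTensor_le (S : H →L[ℂ] H) (T : K →L[ℂ] K) :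
    ‖opTensor S T‖ ≤ ‖S‖ * ‖T‖ := by
  refine ContinuousLinearMap.opNorm_le_bound _ (by positivity) fun x => ?_
  induction x using UniformSpace.Completion.induction_on with
  | hp => exact isClosed_le (by fun_prop) (by fun_prop)
  | ih z =>
    rw [opTensor_coe, UniformSpace.Completion.norm_coe, UniformSpace.Completion.norm_coe]
    exact ((TensorProduct.mapL S T).le_opNorm z).trans
      (mul_le_mul_of_nonneg_right (TensorProduct.norm_mapL_le S T) (norm_nonneg _))

theorem opTensor_add_left (S S' : H →L[ℂ] H) (T : K →L[ℂ] K) :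
    opTensor (S + S') T = opTensor S T + opTensor S' T :=
  clm_hTensor_ext fun z => by
    rw [add_apply, opTensor_coe, opTensor_coe, opTensor_coe,
      TensorProduct.mapL_add_left, add_apply, UniformSpace.Completion.coe_add]

theorem opTensor_add_right (S : H →L[ℂ] H) (T T' : K →L[ℂ] K) :
    opTensor S (T + T') = opTensor S T + opTensor S T' :=
  clm_hTensor_ext fun z => by
    rw [add_apply, opTensor_coe, opTensor_coe, opTensor_coe,
      TensorProduct.mapL_add_right, add_apply, UniformSpace.Completion.coe_add]

theorem opTensor_smul_left (c : ℂ) (S : H →L[ℂ] H) (T : K →L[ℂ] K) :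
    opTensor (c • S) T = c • opTensor S T :=
  clm_hTensor_ext fun z => by
    rw [smul_apply, opTensor_coe, opTensor_coe,
      TensorProduct.mapL_smul_left, smul_apply,
      UniformSpace.Completion.coe_smul]

theorem opTensor_smul_right (c : ℂ) (S : H →L[ℂ] H) (T : K →L[ℂ] K) :
    opTensor S (c • T) = c • opTensor S T :=
  clm_hTensor_ext fun z => by
    rw [smul_apply, opTensor_coe, opTensor_coe,
      TensorProduct.mapL_smul_right, smul_apply,
      UniformSpace.Completion.coe_smul]

variable (H K) in
/-- `opTensor` as a bilinear map. -/
def opTensorBilin :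
    (H →L[ℂ] H) →ₗ[ℂ] (K →L[ℂ] K) →ₗ[ℂ] (HTensor H K →L[ℂ] HTensor H K) :=
  LinearMap.mk₂ ℂ opTensor opTensor_add_left opTensor_smul_left opTensor_add_right
    opTensor_smul_right

end OpTensor

theorem mem_of_mem_closure_span {E F : Type*} [NormedAddCommGroup E] [NormedSpace ℂ E]
    [NormedAddCommGroup F] [NormedSpace ℂ F] {s : Set E} {W : Submodule ℂ F}
    (hW : IsClosed (W : Set F)) (f : E →ₗ[ℂ] F) {c : ℝ} (hf : ∀ x, ‖f x‖ ≤ c * ‖x‖)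
    (h : ∀ x ∈ s, f x ∈ W) {x : E} (hx : x ∈ (Submodule.span ℂ s).topologicalClosure) :
    f x ∈ W := by
  have h1 : Submodule.span ℂ s ≤ W.comap f := Submodule.span_le.mpr h
  exact Submodule.topologicalClosure_minimal _ h1
    (hW.preimage (AddMonoidHomClass.continuous_of_bound f c hf)) hx

-- Since S ⊗ T is bounded in each variable separately, the closures are absorbed one factor at a
-- time.
set_option maxHeartbeats 2000000 in
set_option synthInstance.maxHeartbeats 200000 in
theorem spatialTensor_closure_span_eq {H K I J : Type*} [NormedAddCommGroup H]
    [InnerProductSpace ℂ H] [NormedAddCommGroup K] [InnerProductSpace ℂ K]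
    (f : I → H →L[ℂ] H) (g : J → K →L[ℂ] K) :
    spatialTensor (Submodule.span ℂ (Set.range f)).topologicalClosure
      (Submodule.span ℂ (Set.range g)).topologicalClosure
      = (Submodule.span ℂ
          (Set.range fun p : I × J => opTensor (f p.1) (g p.2))).topologicalClosure := by
  refine le_antisymm ?_ (Submodule.topologicalClosure_mono (Submodule.span_mono ?_))
  · refine Submodule.topologicalClosure_minimal _ (Submodule.span_le.mpr ?_)
      (Submodule.isClosed_topologicalClosure _)
    rintro _ ⟨S, hS, T, hT, rfl⟩
    have h1 : ∀ T, ‖opTensorBilin H K S T‖ ≤ ‖S‖ * ‖T‖ := norm_opTensor_le S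
    refine mem_of_mem_closure_span (E := K →L[ℂ] K) (F := HTensor H K →L[ℂ] HTensor H K)
      (Submodule.isClosed_topologicalClosure _) (opTensorBilin H K S) h1 ?_ hT
    rintro _ ⟨j, rfl⟩
    have h2 : ∀ S, ‖(opTensorBilin H K).flip (g j) S‖ ≤ ‖g j‖ * ‖S‖ := fun S =>
      (norm_opTensor_le S (g j)).trans_eq (mul_comm _ _)
    refine mem_of_mem_closure_span (E := H →L[ℂ] H) (F := HTensor H K →L[ℂ] HTensor H K)
      (Submodule.isClosed_topologicalClosure _) ((opTensorBilin H K).flip (g j)) h2 ?_ hS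
    rintro _ ⟨i, rfl⟩
    exact Submodule.le_topologicalClosure _ (Submodule.subset_span ⟨(i, j), rfl⟩)
  · rintro _ ⟨p, rfl⟩
    exact ⟨_, Submodule.le_topologicalClosure _ (Submodule.subset_span ⟨p.1, rfl⟩), _,
      Submodule.le_topologicalClosure _ (Submodule.subset_span ⟨p.2, rfl⟩), rfl⟩

variable {G : Type*} [Group G] [DecidableEq G]

variable (G) in
/-- `v ↦ ∑ v(g) λ(g)`. -/
def groupMap : (G →₀ ℂ) →ₗ[ℂ] (L2 G →L[ℂ] L2 G) := Finsupp.linearCombination ℂ leftReg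

variable (G) in
/-- `v ↦ ∑ v(i, g) e_{i0} ⊗ λ(g)`. -/
def colMap : (ℕ × G →₀ ℂ) →ₗ[ℂ] (HTensor (L2 ℕ) (L2 G) →L[ℂ] HTensor (L2 ℕ) (L2 G)) :=
  Finsupp.linearCombination ℂ fun p => opTensor (matUnit p.1 0) (leftReg p.2)

variable (G) in
/-- `v ↦ ∑ v(i, g) e_{0i} ⊗ e_{1g}`. -/
def rowMap : (ℕ × G →₀ ℂ) →ₗ[ℂ] (HTensor (L2 ℕ) (L2 G) →L[ℂ] HTensor (L2 ℕ) (L2 G)) :=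
  Finsupp.linearCombination ℂ fun p => opTensor (matUnit 0 p.1) (matUnit 1 p.2)

variable (G) in
/-- The element of the intersection space with a given finitely supported family. -/
def interMap : (ℕ × G →₀ ℂ) →ₗ[ℂ]
    (WithLp 2 (HTensor (L2 ℕ) (L2 G) × HTensor (L2 ℕ) (L2 G)) →L[ℂ]
      WithLp 2 (HTensor (L2 ℕ) (L2 G) × HTensor (L2 ℕ) (L2 G))) :=
  diagOp ∘ₗ (colMap G).prod (rowMap G)

omit [DecidableEq G] in
theorem reducedCStar_eq : reducedCStar G = (LinearMap.range (groupMap G)).topologicalClosure := by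
  rw [groupMap, Finsupp.range_linearCombination, reducedCStar]

omit [DecidableEq G] in
theorem colTensor_eq : spatialTensor (colSpace ℕ 0) (reducedCStar G)
    = (LinearMap.range (colMap G)).topologicalClosure := by
  rw [colMap, Finsupp.range_linearCombination, colSpace, reducedCStar,
    spatialTensor_closure_span_eq]

theorem rowTensor_eq : spatialTensor (rowSpace ℕ 0) (rowSpace G 1)
    = (LinearMap.range (rowMap G)).topologicalClosure := by
  rw [rowMap, Finsupp.range_linearCombination, rowSpace, rowSpace,
    spatialTensor_closure_span_eq]

theorem linearMap_apply_linearCombination {I E : Type*} [AddCommGroup E] [Module ℂ E]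
    [DecidableEq I] (f : I → E) (φ : E →ₗ[ℂ] ℂ) (v : I →₀ ℂ) (i : I) (c : ℂ)
    (h : ∀ j, φ (f j) = if j = i then c else 0) :
    φ (Finsupp.linearCombination ℂ f v) = v i * c := by
  induction v using Finsupp.induction_linear with
  | zero => simp
  | add u w hu hw => rw [map_add, map_add, hu, hw, Finsupp.add_apply, add_mul]
  | single j a =>
    rw [Finsupp.linearCombination_single, map_smul, h, Finsupp.single_apply]
    split_ifs <;> simp

theorem inner_groupMap (v : G →₀ ℂ) (t s : G) :
    inner ℂ (bvec t) (groupMap G v (bvec s)) = v (t * s⁻¹) := by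
  rw [← mul_one (v _)]
  refine linearMap_apply_linearCombination leftReg (coeffFun (bvec s) (bvec t)) v _ 1 fun g => ?_
  simp only [coeffFun, LinearMap.coe_mk, AddHom.coe_mk, leftReg_bvec, inner_bvec]
  simp only [eq_mul_inv_iff_mul_eq, eq_comm]

theorem inner_colMap (v : ℕ × G →₀ ℂ) (p q : ℕ × G) :
    inner ℂ (tensorVec p) (colMap G v (tensorVec q))
      = if q.1 = 0 then v (p.1, p.2 * q.2⁻¹) else 0 := by
  have := linearMap_apply_linearCombination
    (fun p : ℕ × G => opTensor (matUnit p.1 0) (leftReg p.2))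
    (coeffFun (tensorVec q) (tensorVec p)) v (p.1, p.2 * q.2⁻¹) (if q.1 = 0 then 1 else 0)
    fun g => by
      simp only [coeffFun, LinearMap.coe_mk, AddHom.coe_mk, tensorVec, opTensor_vecTensor,
        leftReg_bvec, matUnit_bvec, inner_vecTensor, inner_bvec]
      obtain ⟨g1, g2⟩ := g
      simp only [Prod.mk.injEq, eq_mul_inv_iff_mul_eq]
      by_cases h : q.1 = 0
      · have h1 : p.1 = g1 ↔ g1 = p.1 := eq_comm
        have h2 : p.2 = g2 * q.2 ↔ g2 * q.2 = p.2 := eq_comm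
        simp only [h, if_true, inner_bvec, h1, h2, ite_and, ite_mul, one_mul, zero_mul]
      · simp [h, Ne.symm h]
  refine Eq.trans this ?_
  split_ifs <;> simp

theorem inner_rowMap (v : ℕ × G →₀ ℂ) (p q : ℕ × G) :
    inner ℂ (tensorVec p) (rowMap G v (tensorVec q)) = if p = (0, 1) then v q else 0 := by
  have := linearMap_apply_linearCombination
    (fun p : ℕ × G => opTensor (matUnit 0 p.1) (matUnit 1 p.2))
    (coeffFun (tensorVec q) (tensorVec p)) v q (if p = (0, 1) then 1 else 0)
    fun g => by
      simp only [coeffFun, LinearMap.coe_mk, AddHom.coe_mk, tensorVec, opTensor_vecTensor,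
        matUnit_bvec, inner_vecTensor]
      obtain ⟨g1, g2⟩ := g
      obtain ⟨q1, q2⟩ := q
      obtain ⟨p1, p2⟩ := p
      by_cases h1 : g1 = q1 <;> by_cases h2 : g2 = q2 <;>
        simp [h1, h2, inner_bvec, ← ite_and, and_comm]
  refine Eq.trans this ?_
  split_ifs <;> simp

theorem colCoeff_apply (X : HTensor (L2 ℕ) (L2 G) →L[ℂ] HTensor (L2 ℕ) (L2 G)) (p : ℕ × G) :
    colCoeff G X p = inner ℂ (tensorVec p) (X (tensorVec (0, 1))) := rfl

theorem rowCoeff_apply (X : HTensor (L2 ℕ) (L2 G) →L[ℂ] HTensor (L2 ℕ) (L2 G)) (p : ℕ × G) :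
    rowCoeff G X p = inner ℂ (tensorVec (0, 1)) (X (tensorVec p)) := rfl

theorem colCoeff_colMap (v : ℕ × G →₀ ℂ) : colCoeff G (colMap G v) = v := by
  ext p
  simp [colCoeff_apply, inner_colMap]

theorem rowCoeff_rowMap (v : ℕ × G →₀ ℂ) : rowCoeff G (rowMap G v) = v := by
  ext p
  simp [rowCoeff_apply, inner_rowMap]

/-- The norm in `R ⊗ R(G)` is at most the norm of an operator whose column consists of the same
coefficients. -/
theorem norm_le_of_rowCoeff {X : HTensor (L2 ℕ) (L2 G) →L[ℂ] HTensor (L2 ℕ) (L2 G)}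
    (hX : X ∈ spatialTensor (rowSpace ℕ 0) (rowSpace G 1))
    (Y : HTensor (L2 ℕ) (L2 G) →L[ℂ] HTensor (L2 ℕ) (L2 G))
    (h : rowCoeff G X = colCoeff G Y) : ‖X‖ ≤ ‖Y‖ := by
  -- Being supported in the row (0, 1) is a closed condition, so it passes from finite families to
  -- `X`.
  have hk : ∀ p q, inner ℂ (tensorVec p) (X (tensorVec q))
      = if p = (0, 1) then rowCoeff G X q else 0 := by
    intro p q
    have hcl : IsClosed {X : HTensor (L2 ℕ) (L2 G) →L[ℂ] HTensor (L2 ℕ) (L2 G) |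
        inner ℂ (tensorVec p) (X (tensorVec q))
          = if p = (0, 1) then inner ℂ (tensorVec (0, 1)) (X (tensorVec q)) else 0} := by
      refine isClosed_eq (by fun_prop) ?_
      split_ifs <;> fun_prop
    rw [rowTensor_eq] at hX
    refine closure_minimal ?_ hcl hX
    rintro _ ⟨v, rfl⟩
    simp [inner_rowMap]
  refine norm_le_of_kernelBound orthonormal_tensorVec isTotal_tensorVec X Y.opNorm_nonneg ?_
  have hY := kernelBound_inner orthonormal_tensorVec Y
  intro s t η ξ
  simp only [hk, h, colCoeff_apply]
  -- Only p = (0, 1) contributes; Cauchy–Schwarz then leaves the ℓ₂ norm of a column of `Y`.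
  have e : ∑ p ∈ s, ∑ q ∈ t, η p * (if p = (0, 1) then
      inner ℂ (tensorVec q) (Y (tensorVec (0, 1))) else 0) * ξ q
      = (if (0, 1) ∈ s then η (0, 1) else 0)
        * ∑ q ∈ t, inner ℂ (tensorVec q) (Y (tensorVec (0, 1))) * ξ q := by
    rw [← Finset.sum_ite_eq' s ((0, 1) : ℕ × G) η, Finset.sum_mul]
    refine Finset.sum_congr rfl fun p _ => ?_
    rw [Finset.mul_sum]
    refine Finset.sum_congr rfl fun q _ => ?_
    split_ifs <;> ring
  rw [e, norm_mul, mul_comm ‖Y‖, mul_assoc]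
  refine mul_le_mul ?_ ?_ (norm_nonneg _) (Real.sqrt_nonneg _)
  · split_ifs with h1
    · exact Real.le_sqrt_of_sq_le
        (Finset.single_le_sum (f := fun p => ‖η p‖ ^ 2) (fun _ _ => by positivity) h1)
    · simp
  · refine (norm_sum_le _ _).trans ?_
    simp only [norm_mul]
    refine (Real.sum_mul_le_sqrt_mul_sqrt _ _ _).trans ?_
    exact mul_le_mul_of_nonneg_right (hY.sum_sq_le Y.opNorm_nonneg (0, 1) t) (Real.sqrt_nonneg _)

set_option maxHeartbeats 2000000 in
set_option synthInstance.maxHeartbeats 200000 in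
theorem isometry_diagOp {H K : Type*} [NormedAddCommGroup H] [InnerProductSpace ℂ H]
    [NormedAddCommGroup K] [InnerProductSpace ℂ K] :
    Isometry (diagOp : ((H →L[ℂ] H) × (K →L[ℂ] K)) →ₗ[ℂ] _) :=
  AddMonoidHomClass.isometry_of_norm (diagOp : ((H →L[ℂ] H) × (K →L[ℂ] K)) →ₗ[ℂ] _) fun p =>
    le_antisymm (norm_diagOp_le p.1 p.2)
      (max_le (norm_le_norm_diagOp p.1 p.2).1 (norm_le_norm_diagOp p.1 p.2).2)

-- By `hle`, approximating the first component alone suffices: for the same v, the error in the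
-- second component is no larger.
set_option maxHeartbeats 2000000 in
set_option synthInstance.maxHeartbeats 200000 in
theorem interSpace_eq_closure_range {H K V W : Type*} [NormedAddCommGroup H]
    [InnerProductSpace ℂ H] [NormedAddCommGroup K] [InnerProductSpace ℂ K] [CompleteSpace H]
    [CompleteSpace K] [AddCommGroup V] [Module ℂ V]
    [AddCommGroup W] [Module ℂ W] [TopologicalSpace W] [T2Space W] {X : Submodule ℂ (H →L[ℂ] H)}
    {Y : Submodule ℂ (K →L[ℂ] K)} {j : (H →L[ℂ] H) →ₗ[ℂ] W} {k : (K →L[ℂ] K) →ₗ[ℂ] W}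
    {α : V →ₗ[ℂ] H →L[ℂ] H} {β : V →ₗ[ℂ] K →L[ℂ] K}
    (hX : X = (LinearMap.range α).topologicalClosure)
    (hY : Y = (LinearMap.range β).topologicalClosure) (hj : Continuous j) (hk : Continuous k)
    (hjk : ∀ v, j (α v) = k (β v)) (hle : ∀ S, ∀ T ∈ Y, k T = j S → ‖T‖ ≤ ‖S‖) :
    interSpace X j Y k = (LinearMap.range (diagOp ∘ₗ α.prod β)).topologicalClosure := by
  have hα : ∀ v, α v ∈ X := fun v => hX ▸ Submodule.le_topologicalClosure _ ⟨v, rfl⟩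
  have hβ : ∀ v, β v ∈ Y := fun v => hY ▸ Submodule.le_topologicalClosure _ ⟨v, rfl⟩
  apply le_antisymm
  · rintro _ ⟨⟨S, T⟩, ⟨⟨hS, hT⟩, hST⟩, rfl⟩
    have hST' : j S = k T := hST
    change diagOp (S, T) ∈ closure _
    rw [Metric.mem_closure_iff]
    intro ε hε
    have hS' : S ∈ closure (LinearMap.range α : Set (H →L[ℂ] H)) := by
      rw [hX] at hS
      exact hS
    obtain ⟨_, ⟨v, rfl⟩, hv⟩ := Metric.mem_closure_iff.mp hS' ε hε
    refine ⟨diagOp (α v, β v), ⟨v, rfl⟩, ?_⟩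
    have hT' : ‖T - β v‖ ≤ ‖S - α v‖ := by
      refine hle _ _ (Submodule.sub_mem _ hT (hβ v)) ?_
      rw [map_sub, map_sub, hjk, hST']
    rw [(isometry_diagOp (H := H) (K := K)).dist_eq, Prod.dist_eq]
    refine max_lt hv (lt_of_le_of_lt ?_ hv)
    rw [dist_eq_norm, dist_eq_norm]
    exact hT'
  · refine Submodule.topologicalClosure_minimal _ ?_ ?_
    · rintro _ ⟨v, rfl⟩
      exact ⟨(α v, β v), ⟨⟨hα v, hβ v⟩, hjk v⟩, rfl⟩
    -- An isometry on a complete space is a closed map, and the compatibility of coefficients is a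
    -- closed condition.
    · refine (isometry_diagOp (H := H) (K := K)).isClosedEmbedding.isClosedMap _ ?_
      subst hX hY
      exact ((Submodule.isClosed_topologicalClosure _).prod
        (Submodule.isClosed_topologicalClosure _)).inter
        (isClosed_eq (hj.comp continuous_fst) (hk.comp continuous_snd))

variable (G) in
set_option maxHeartbeats 2000000 in
set_option synthInstance.maxHeartbeats 200000 in
theorem interSpace_eq :
    interSpace (spatialTensor (colSpace ℕ 0) (reducedCStar G)) (colCoeff G)
      (spatialTensor (rowSpace ℕ 0) (rowSpace G 1)) (rowCoeff G)
      = (LinearMap.range (interMap G)).topologicalClosure := by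
  refine interSpace_eq_closure_range colTensor_eq rowTensor_eq ?_ ?_
    (fun v => (colCoeff_colMap v).trans (rowCoeff_rowMap v).symm)
    fun S T hT h => norm_le_of_rowCoeff hT S h
  · refine continuous_pi fun p => ?_
    change Continuous fun X : HTensor (L2 ℕ) (L2 G) →L[ℂ] HTensor (L2 ℕ) (L2 G) =>
      inner ℂ (tensorVec p) (X (tensorVec (0, 1)))
    fun_prop
  · refine continuous_pi fun p => ?_
    change Continuous fun X : HTensor (L2 ℕ) (L2 G) →L[ℂ] HTensor (L2 ℕ) (L2 G) =>
      inner ℂ (tensorVec (0, 1)) (X (tensorVec p))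
    fun_prop

end Density

/-! ### Matrix norms of finitely supported families -/

section MatrixNorms

variable {G : Type*} [Group G] [DecidableEq G] {n : ℕ}

theorem kernelBound_groupMap (T : Matrix (Fin n) (Fin n) (G →₀ ℂ)) :
    KernelBound (groupKernel fun k l => ⇑(T k l)) ‖blockOp (T.map (groupMap G))‖ := by
  have h := kernelBound_blockOp (orthonormal_bvec G) (T.map (groupMap G))
  simp only [Matrix.map_apply, inner_groupMap] at h
  exact h

theorem norm_groupMap_le (T : Matrix (Fin n) (Fin n) (G →₀ ℂ)) {C : ℝ} (hC : 0 ≤ C)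
    (h : KernelBound (groupKernel fun k l => ⇑(T k l)) C) :
    ‖blockOp (T.map (groupMap G))‖ ≤ C := by
  refine norm_blockOp_le (orthonormal_bvec G) (isTotal_bvec G) _ hC ?_
  simp only [Matrix.map_apply, inner_groupMap]
  exact h

/-- The orthonormal basis of the Hilbert space on which the intersection space acts. -/
def interVec : (ℕ × G) ⊕ (ℕ × G) → WithLp 2 (HTensor (L2 ℕ) (L2 G) × HTensor (L2 ℕ) (L2 G)) :=
  sumVec tensorVec tensorVec

theorem inner_interMap (v : ℕ × G →₀ ℂ) (p q : (ℕ × G) ⊕ (ℕ × G)) :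
    inner ℂ (interVec p) (interMap G v (interVec q)) = match p, q with
      | .inl p, .inl q => if q.1 = 0 then v (p.1, p.2 * q.2⁻¹) else 0
      | .inr p, .inr q => if p = (0, 1) then v q else 0
      | _, _ => 0 := by
  have h : ∀ x, interMap G v x = diagOp (colMap G v, rowMap G v) x := fun _ => rfl
  rcases p with p | p <;> rcases q with q | q <;>
    simp [h, interVec, sumVec, diagOp_apply, inner_colMap, inner_rowMap]

theorem interBound_interMap (T : Matrix (Fin n) (Fin n) (ℕ × G →₀ ℂ)) :
    InterBound (fun k l => ⇑(T k l)) ‖blockOp (T.map (interMap G))‖ := by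
  have h := kernelBound_blockOp (b := interVec) (orthonormal_sumVec orthonormal_tensorVec
    orthonormal_tensorVec) (T.map (interMap G))
  simp only [Matrix.map_apply, inner_interMap] at h
  constructor
  · refine h.compress (blockOp (T.map (interMap G))).opNorm_nonneg Set.univ Set.univ
      (fun p => (p.1, .inl p.2)) (fun p => (p.1, .inl p.2)) ?_ ?_ ?_ ?_
    · rintro ⟨p1, p2⟩ - ⟨q1, q2⟩ - h
      simpa using h
    · rintro ⟨p1, p2⟩ - ⟨q1, q2⟩ - h
      simpa using h
    · exact fun p q _ _ => rfl
    · simp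
  · refine h.compress (blockOp (T.map (interMap G))).opNorm_nonneg Set.univ Set.univ
      (fun p => (p.1, .inr p.2)) (fun p => (p.1, .inr p.2)) ?_ ?_ ?_ ?_
    · rintro ⟨p1, p2⟩ - ⟨q1, q2⟩ - h
      simpa using h
    · rintro ⟨p1, p2⟩ - ⟨q1, q2⟩ - h
      simpa using h
    · exact fun p q _ _ => rfl
    · simp

/-- The two diagonal blocks are bounded separately and added; the resulting factor 2 is harmless. -/
theorem norm_interMap_le (T : Matrix (Fin n) (Fin n) (ℕ × G →₀ ℂ)) {C : ℝ} (hC : 0 ≤ C)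
    (h : InterBound (fun k l => ⇑(T k l)) C) :
    ‖blockOp (T.map (interMap G))‖ ≤ C + C := by
  refine norm_blockOp_le (b := interVec) (orthonormal_sumVec orthonormal_tensorVec
    orthonormal_tensorVec) (isTotal_sumVec isTotal_tensorVec isTotal_tensorVec) _
    (by linarith) ?_
  simp only [Matrix.map_apply, inner_interMap]
  have h1 := h.1.compress hC (b := fun p q : Fin n × ((ℕ × G) ⊕ (ℕ × G)) =>
      match p.2, q.2 with
      | .inl x, .inl y => colKernel (fun k l => ⇑(T k l)) (p.1, x) (q.1, y)
      | _, _ => 0) {p | p.2.isLeft} {q | q.2.isLeft}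
      (fun p => (p.1, p.2.elim id id)) (fun p => (p.1, p.2.elim id id)) ?_ ?_ ?_ ?_
  · have h2 := h.2.compress hC (b := fun p q : Fin n × ((ℕ × G) ⊕ (ℕ × G)) =>
        match p.2, q.2 with
        | .inr x, .inr y => rowKernel (fun k l => ⇑(T k l)) (p.1, x) (q.1, y)
        | _, _ => 0) {p | p.2.isRight} {q | q.2.isRight}
        (fun p => (p.1, p.2.elim id id)) (fun p => (p.1, p.2.elim id id)) ?_ ?_ ?_ ?_
    · convert h1.add h2 using 1
      ext ⟨k, p | p⟩ ⟨l, q | q⟩ <;> simp [colKernel, rowKernel]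
    · rintro ⟨k, p | p⟩ hp ⟨l, q | q⟩ hq e <;> simp_all
    · rintro ⟨k, p | p⟩ hp ⟨l, q | q⟩ hq e <;> simp_all
    · rintro ⟨k, p | p⟩ ⟨l, q | q⟩ hp hq <;> simp_all
    · rintro ⟨k, p | p⟩ ⟨l, q | q⟩ e <;> simp_all
  · rintro ⟨k, p | p⟩ hp ⟨l, q | q⟩ hq e <;> simp_all
  · rintro ⟨k, p | p⟩ hp ⟨l, q | q⟩ hq e <;> simp_all
  · rintro ⟨k, p | p⟩ ⟨l, q | q⟩ hp hq <;> simp_all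
  · rintro ⟨k, p | p⟩ ⟨l, q | q⟩ e <;> simp_all

end MatrixNorms

end OpSpace

end

/-! ### The complete isomorphism -/

set_option maxHeartbeats 2000000 in
set_option synthInstance.maxHeartbeats 200000 in
theorem proposition9 :
    OpSpace.CompletelyIsomorphic
      (OpSpace.reducedCStar (FreeGroup ℕ))
      (OpSpace.interSpace
        (OpSpace.spatialTensor (OpSpace.colSpace ℕ 0) (OpSpace.reducedCStar (FreeGroup ℕ)))
        (OpSpace.colCoeff (FreeGroup ℕ))
        (OpSpace.spatialTensor (OpSpace.rowSpace ℕ 0) (OpSpace.rowSpace (FreeGroup ℕ) 1))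
        (OpSpace.rowCoeff (FreeGroup ℕ))) := by
  open OpSpace in
  set r : (FreeGroup ℕ →₀ ℂ) ≃ₗ[ℂ] (ℕ × FreeGroup ℕ →₀ ℂ) :=
    Finsupp.domLCongr indexEquiv.symm with hr
  have hra : ∀ v p, r v p = v (indexEquiv p) := fun v p => by simp [hr]
  -- After relabelling by the bijection, both spaces are closures of images of the same space of
  -- finitely supported functions.
  have hrange : LinearMap.range (interMap (FreeGroup ℕ))
      = LinearMap.range (interMap (FreeGroup ℕ) ∘ₗ r.toLinearMap) := by
    rw [LinearMap.range_comp, LinearEquiv.range, Submodule.map_top]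
  rw [interSpace_eq, reducedCStar_eq, hrange]
  have hmap : ∀ (n : ℕ) (T : Matrix (Fin n) (Fin n) (FreeGroup ℕ →₀ ℂ)),
      T.map (interMap (FreeGroup ℕ) ∘ₗ r.toLinearMap) = (T.map r).map (interMap (FreeGroup ℕ)) :=
    fun n T => rfl
  -- Here 12 = 2 · 6, the 2 coming from adding the two diagonal blocks.
  refine completelyIsomorphic_closure_range (c := 12) (d := 7) _ _ (fun n T => ?_) (fun n T => ?_)
  · have h0 := (blockOp (T.map (groupMap (FreeGroup ℕ)))).opNorm_nonneg
    have h1 := interBound_indexEquiv h0 (kernelBound_groupMap T)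
    rw [hmap]
    refine (norm_interMap_le (T.map r) (C := 6 * ‖blockOp (T.map (groupMap (FreeGroup ℕ)))‖)
      (by linarith) ?_).trans (by linarith)
    convert h1 using 4 with k l p
    exact hra _ _
  · rw [hmap]
    have h0 := (blockOp ((T.map r).map (interMap (FreeGroup ℕ)))).opNorm_nonneg
    have h1 := kernelBound_indexEquiv_symm h0 (interBound_interMap (T.map r))
    refine norm_groupMap_le T (by linarith) ?_
    convert h1 using 4 with k l x
    simp [hra]
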